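/- Let $\mathfrak S_N$ be the set of permutations $\pi=\pi_1\pi_2\cdots\pi_N$ of $\{1,\dots,N\}$. Let $g,\ell\ge 1$ and $m\geq 1$. For a word $\pi=\pi_1\cdots\pi_N$ put $$g\mathsf{Excp}_m(\pi)=\{i : \pi_i\ge i+g,\ \pi_i\ge m\},\qquad g\mathsf{Excl}_m(\pi)=\{\pi_i : i\in g\mathsf{Excp}_m(\pi)\},\qquad g\mathsf{exc}_\ell(\pi)=|\{i : \pi_i\ge i+g,\ i\ge \ell\}|,$$ $$g\mathsf{den}_m(\pi)=\sum_{i\in g\mathsf{Excp}_m(\pi)}(i+g-1)+\mathsf{inv}(g\mathsf{Exc}_m(\pi))+\mathsf{inv}(g\mathsf{Nexc}_m(\pi)),$$ where $g\mathsf{Exc}_m(\pi)$ (resp. $g\mathsf{Nexc}_m(\pi)$) is the subword of $\pi$ formed by the letters at the places in (resp. not in) $g\mathsf{Excp}_m(\pi)$, and $\mathsf{inv}$ is the number of inversions. Fix $g,\ell\ge1$ and $n\ge g+\ell$. For $\pi\in\mathfrak S_{n-1}$ let $g\mathsf{Excl}_{g+\ell}(\pi)=\{e_1<\cdots<e_s\}$,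 $e_{s+1}=n$, and $$\mathcal A=\{i<\ell : \pi_i\in g\mathsf{Excl}_{g+\ell}(\pi)\},\qquad \mathcal B^*=\{i<\ell : \pi_i\notin g\mathsf{Excl}_{g+\ell}(\pi)\}.$$ Label the $n$ spaces of the index sequence $12\cdots(n-1)$ with $0,\dots,n-1$ as follows: the rightmost $g$ spaces get $0,1,\dots,g-1$ from right to left; the space before the index $e_i-(g-1)$ gets $g+s-i$ $(1\le i\le s)$; the spaces before the indices in $\mathcal B^*$ get $g+s,\dots,g\mathsf{exc}_\ell(\pi)+g+\ell-2$ from left to right; the remaining spaces get $g\mathsf{exc}_\ell(\pi)+g+\ell-1,\dots,n-1$ from left to right. For $0\le c\le n-1$ let $x$ be the index immediately after the space labelled $c$ (for $c=0$ this space is the one after the index $n-1$, and we put $x=n$). Define a word $\psi(\pi,c)$ of length $n$ as follows. * ($\alpha$) Suppose $x\in\mathcal A=\{i_1<\cdots<i_k\}$, $x=i_y$. Replace simultaneously every $e_j$, $1\le j\le s$, in $\pi$ by $e_{j+1}$ to obtain $\sigma$. Then $\psi(\pi,c)$ is obtained from $\sigma$ by replacing $\sigma_{x}$ by $e_1$,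 replacing $\sigma_{i_j}$ by $\sigma_{i_{j-1}}$ for $y<j\le k$, and inserting $\sigma_{i_k}$ immediately before $\sigma_\ell$. * ($\beta^*$) Suppose $x\in\mathcal B^*=\{i_1<\cdots<i_k\}$, $x=i_y$. Apply to $\pi$ the procedure of ($\alpha$), with this $i_1,\dots,i_k$ and $y$, to obtain a word $\theta=\theta_1\cdots\theta_n$. Let $e'_1<\cdots<e'_r$ be the letters $\theta_i$ with $i\in g\mathsf{Excp}_{g+\ell}(\theta)$ and $i<\ell$. Then $\psi(\pi,c)$ is obtained from $\theta$ by replacing $e'_j$ by $e'_{j-1}$ for $1<j\le r$ and $e'_1$ by $e'_r$. * ($\delta$) Otherwise ($c=0$ or $x\ge\ell$) let $e_y$ be the smallest of $e_1,\dots,e_{s}$ with $x\le e_y-(g-1)$, and let $y=s+1$ if there is none. Replace simultaneously every $e_j$, $y\le j\le s$, in $\pi$ by $e_{j+1}$ to obtain $\sigma$; then $\psi(\pi,c)$ is obtained from $\sigma$ by inserting $e_y$ immediately before $\sigma_x$ (at the end, if $x=n$). Theorem. For all $g,\ell\ge1$ and $n\ge g+\ell$, the words $\psi(\pi,c)$ are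 permutations of $\{1,\dots,n\}$, the map $$\psi:\mathfrak S_{n-1}\times\{0,1,\dots,n-1\}\longrightarrow\mathfrak S_n$$ is a bijection, and for all $\pi\in\mathfrak S_{n-1}$ and $0\le c\le n-1$, $$g\mathsf{exc}_\ell(\psi(\pi,c))=\begin{cases}g\mathsf{exc}_\ell(\pi)&\text{if }0\le c\le g\mathsf{exc}_\ell(\pi)+g+\ell-2,\\ g\mathsf{exc}_\ell(\pi)+1&\text{otherwise,}\end{cases}\qquad g\mathsf{den}_{g+\ell}(\psi(\pi,c))=g\mathsf{den}_{g+\ell}(\pi)+c.$$ -/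

import Mathlib

namespace GapDenert

/-- The one-line notation `π₁ π₂ ⋯ π_N` of a permutation, with places and letters numbered from
`1`; the value is `0` at every other place. -/
def oneLine {N : ℕ} (π : Equiv.Perm (Fin N)) (i : ℕ) : ℕ :=
  if h : 1 ≤ i ∧ i ≤ N then (π ⟨i - 1, by omega⟩ : ℕ) + 1 else 0

/-! ### Statistics of a word `w = w₁ w₂ ⋯ w_N` -/

/-- The set of `g`-gap `ℓ`-level excedance places. -/
def Excp (g ℓ N : ℕ) (w : ℕ → ℕ) : Finset ℕ :=
  {i ∈ Finset.Icc 1 N | i + g ≤ w i ∧ ℓ ≤ w i}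

/-- The set of the other places. -/
def Nexcp (g ℓ N : ℕ) (w : ℕ → ℕ) : Finset ℕ :=
  Finset.Icc 1 N \ Excp g ℓ N w

/-- The set of `g`-gap `ℓ`-level excedance letters. -/
def Excl (g ℓ N : ℕ) (w : ℕ → ℕ) : Finset ℕ :=
  (Excp g ℓ N w).image w

/-- The number of inversions of the subword of `w` formed by the letters at the places in `S`,
in the order in which they occur in `w`. -/
def invOn (w : ℕ → ℕ) (S : Finset ℕ) : ℕ :=
  ({p ∈ S ×ˢ S | p.1 < p.2 ∧ w p.2 < w p.1} : Finset _).card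

/-- The `g`-gap `ℓ`-level Denert statistic. -/
def den (g ℓ N : ℕ) (w : ℕ → ℕ) : ℕ :=
  (∑ i ∈ Excp g ℓ N w, (i + g - 1)) + invOn w (Excp g ℓ N w) + invOn w (Nexcp g ℓ N w)

/-- The `g`-gap `ℓ`-level excedance number. -/
def exc (g ℓ N : ℕ) (w : ℕ → ℕ) : ℕ :=
  ({i ∈ Finset.Icc 1 N | i + g ≤ w i ∧ ℓ ≤ i} : Finset _).card

/-! ### The labelling of the spaces

Throughout, `w` is the one-line notation of a permutation of `{1, …, n - 1}`. The `n` spaces of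
the index sequence `1 2 ⋯ (n - 1)` are numbered `1, …, n`: for `x < n` the space `x` is the one
immediately before the index `x`, and the space `n` is the one after the index `n - 1`. -/

/-- The places to the left of `ℓ` that carry a `g`-gap `(g+ℓ)`-level excedance letter. -/
def setA (g ℓ n : ℕ) (w : ℕ → ℕ) : Finset ℕ :=
  {i ∈ Finset.Icc 1 (n - 1) | w i ∈ Excl g (g + ℓ) (n - 1) w ∧ i < ℓ}

/-- The places to the left of `ℓ` that do not carry a `g`-gap `(g+ℓ)`-level excedance letter. -/
def setB (g ℓ n : ℕ) (w : ℕ → ℕ) : Finset ℕ :=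
  {i ∈ Finset.Icc 1 (n - 1) | w i ∉ Excl g (g + ℓ) (n - 1) w ∧ i < ℓ}

/-- The spaces that are not among the rightmost `g` spaces, are not immediately before an index
`e - (g - 1)` with `e` an excedance letter, and are not immediately before an index in `setB`. -/
def remainingSpaces (g ℓ n : ℕ) (w : ℕ → ℕ) : Finset ℕ :=
  {x ∈ Finset.Icc 1 (n - g) | x + (g - 1) ∉ Excl g (g + ℓ) (n - 1) w ∧ x ∉ setB g ℓ n w}

/-- The label of the space `x` in the `g`-gap-`(g+ℓ)`-level-den-labelling. If
`e₁ < ⋯ < e_s` are the excedance letters and `e_i = x + (g - 1)`, then the number of larger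
excedance letters is `s - i`. -/
def label (g ℓ n : ℕ) (w : ℕ → ℕ) (x : ℕ) : ℕ :=
  if n - g < x then n - x
  else if x + (g - 1) ∈ Excl g (g + ℓ) (n - 1) w then
    g + ({e ∈ Excl g (g + ℓ) (n - 1) w | x + (g - 1) < e} : Finset _).card
  else if x ∈ setB g ℓ n w then
    g + (Excl g (g + ℓ) (n - 1) w).card + ({j ∈ setB g ℓ n w | j < x} : Finset _).card
  else
    exc g ℓ (n - 1) w + g + ℓ - 1 + ({j ∈ remainingSpaces g ℓ n w | j < x} : Finset _).card

/-- The space with label `c`. -/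
def space (g ℓ n : ℕ) (w : ℕ → ℕ) (c : ℕ) : ℕ :=
  ({x ∈ Finset.Icc 1 n | label g ℓ n w x = c}).min.untopD n

/-- The insertion letter of the space `x`, for `x ≥ ℓ`: the smallest excedance letter `e` for
which the space `x` is to the left of the index `e - (g - 1)`, and `n` if there is none. -/
def insertionLetter (g ℓ n : ℕ) (w : ℕ → ℕ) (x : ℕ) : ℕ :=
  ({e ∈ Excl g (g + ℓ) (n - 1) w | x + (g - 1) ≤ e}).min.untopD n

/-! ### The maps -/

/-- With `e₁ < ⋯ < e_s` the excedance letters and `e_{s+1} = n`, the word obtained from `w` by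
replacing every `e_j ≥ a` with `e_{j+1}`. -/
def raise (g ℓ n : ℕ) (w : ℕ → ℕ) (a : ℕ) (i : ℕ) : ℕ :=
  if w i ∈ Excl g (g + ℓ) (n - 1) w ∧ a ≤ w i then
    ({e ∈ Excl g (g + ℓ) (n - 1) w | w i < e}).min.untopD n
  else w i

/-- The smallest excedance letter, and `n` if there is none. -/
def firstLetter (g ℓ n : ℕ) (w : ℕ → ℕ) : ℕ :=
  (Excl g (g + ℓ) (n - 1) w).min.untopD n

/-- The word obtained from `v` by inserting the letter `a` immediately before `v_x`. -/
def insertBefore (v : ℕ → ℕ) (x a : ℕ) (i : ℕ) : ℕ :=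
  if i < x then v i else if i = x then a else v (i - 1)

/-- For a set `S = {i₁ < ⋯ < i_k}` of places to the left of `ℓ` and `x = i_y`: the word obtained
from `v` by replacing `v_x` with `a`, replacing `v_{i_j}` with `v_{i_{j-1}}` for `y < j ≤ k`, and
inserting `v_{i_k}` immediately before `v_ℓ`. -/
def shiftInsert (ℓ : ℕ) (S : Finset ℕ) (x a : ℕ) (v : ℕ → ℕ) : ℕ → ℕ :=
  insertBefore
    (fun i => if i = x then a
      else if i ∈ S ∧ x < i then v (({j ∈ S | j < i}).max.unbotD 0)
      else v i)
    ℓ (v (S.max.unbotD 0))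

/-- With `e'₁ < ⋯ < e'_m` the `g`-gap `(g+ℓ)`-level excedance letters of the word
`v = v₁ ⋯ v_n` at places to the left of `ℓ`, the word obtained by replacing `e'_j` with
`e'_{j-1}` for `1 < j ≤ m` and `e'₁` with `e'_m`. -/
def rotate (g ℓ n : ℕ) (v : ℕ → ℕ) (i : ℕ) : ℕ :=
  let E := ({j ∈ Excp g (g + ℓ) n v | j < ℓ}).image v
  if v i ∈ E then ({e ∈ E | e < v i}).max.unbotD (E.max.unbotD 0) else v i

/-- The map `α`, used when the space labelled `c` is before an index in `setA`. -/
def alpha (g ℓ n : ℕ) (w : ℕ → ℕ) (c : ℕ) : ℕ → ℕ :=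
  shiftInsert ℓ (setA g ℓ n w) (space g ℓ n w c) (firstLetter g ℓ n w) (raise g ℓ n w 0)

/-- The map `β*`, used when the space labelled `c` is before an index in `setB`. -/
def betaStar (g ℓ n : ℕ) (w : ℕ → ℕ) (c : ℕ) : ℕ → ℕ :=
  rotate g ℓ n
    (shiftInsert ℓ (setB g ℓ n w) (space g ℓ n w c) (firstLetter g ℓ n w) (raise g ℓ n w 0))

/-- The map `δ`, used when `c = 0` or the space labelled `c` is before an index `x ≥ ℓ`. For
`c = 0` the space is the last one, and `n` is appended to `w`. -/
def delta (g ℓ n : ℕ) (w : ℕ → ℕ) (c : ℕ) : ℕ → ℕ :=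
  let x := space g ℓ n w c
  let a := insertionLetter g ℓ n w x
  insertBefore (raise g ℓ n w a) x a

/-- The map `ψ`, as a map to words. -/
def psi (g ℓ n : ℕ) (w : ℕ → ℕ) (c : ℕ) : ℕ → ℕ :=
  if space g ℓ n w c ∈ setA g ℓ n w then alpha g ℓ n w c
  else if space g ℓ n w c ∈ setB g ℓ n w then betaStar g ℓ n w c
  else delta g ℓ n w c

end GapDenert

/-!
Each of the maps `α` and `δ`, and `β*` up to a final rotation, inserts a letter `a` at a place `x`
and makes room for it twice: the old letter at `x` moves to the next place of a set `T`, whose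
letter moves on in turn, and every excedance letter `≥ a` is raised to the next one. Along such an
insertion the excedance places and letters and the two inversion numbers can be followed for all
three maps at once: the increase of `den` is a count of excedance letters and of places that turns
out to be the label of `x`. The rotation in `β*` permutes the letters on the excedance places left
of `ℓ` without changing these places, and corrects `den` by the inversions lost or gained there.
As the labels number the spaces, `den` increases by exactly `c`.

The word and the space are recovered from the image. That `n` is an excedance letter while there is
no anchor, the trace left by an insertion at a place `≥ ℓ`, means that `x < ℓ`, and then `α` and
`β*` differ in whether `ℓ` is an excedance place. Within one case the inserted letter can be read
off, and with it the insertion undone. Hence `ψ` is injective, and bijective since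
`(n - 1)! * n = n!`.
-/

namespace GapDenert

open Finset

/-- The word `w` is the one-line notation of a permutation of `{1, …, N}`, extended by `0`. A
self-map of a finite set is a permutation as soon as it is onto, so the image says it all. -/
structure IsWord (N : ℕ) (w : ℕ → ℕ) : Prop where
  image_eq : (Icc 1 N).image w = Icc 1 N
  eq_zero : ∀ i ∉ Icc 1 N, w i = 0

namespace IsWord

variable {N i : ℕ} {w : ℕ → ℕ}

lemma apply_mem (hw : IsWord N w) (hi : i ∈ Icc 1 N) : w i ∈ Icc 1 N :=
  hw.image_eq ▸ mem_image_of_mem w hi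

lemma injOn (hw : IsWord N w) : Set.InjOn w (Icc 1 N : Finset ℕ) :=
  injOn_of_card_image_eq (by rw [hw.image_eq])

end IsWord

section OneLine

variable {N : ℕ}

lemma oneLine_of_mem (π : Equiv.Perm (Fin N)) {i : ℕ} (hi : i ∈ Icc 1 N) :
    oneLine π i = π ⟨i - 1, by grind⟩ + 1 :=
  dif_pos (mem_Icc.1 hi)

lemma oneLine_succ (π : Equiv.Perm (Fin N)) (i : Fin N) : oneLine π (i + 1) = π i + 1 :=
  oneLine_of_mem π (mem_Icc.2 ⟨by omega, i.2⟩)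

lemma isWord_oneLine (π : Equiv.Perm (Fin N)) : IsWord N (oneLine π) where
  image_eq := by
    ext z
    simp only [mem_image, mem_Icc]
    constructor
    · rintro ⟨i, hi, rfl⟩
      rw [oneLine_of_mem π (mem_Icc.2 hi)]
      omega
    · intro hz
      refine ⟨π.symm ⟨z - 1, by omega⟩ + 1, by omega, ?_⟩
      rw [oneLine_succ, Equiv.apply_symm_apply, Nat.sub_add_cancel hz.1]
  eq_zero i hi := dif_neg fun h => hi (mem_Icc.2 h)

lemma oneLine_injective : Function.Injective (oneLine (N := N)) := by
  intro π ρ h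
  ext i
  have hi := congrFun h (i + 1)
  rw [oneLine_succ, oneLine_succ] at hi
  omega

lemma IsWord.exists_oneLine_eq {w : ℕ → ℕ} (hw : IsWord N w) :
    ∃ π : Equiv.Perm (Fin N), oneLine π = w := by
  have hmem (i : Fin N) : (i : ℕ) + 1 ∈ Icc 1 N := mem_Icc.2 ⟨by omega, i.2⟩
  have hbounds (i : Fin N) := mem_Icc.1 (hw.apply_mem (hmem i))
  let f (i : Fin N) : Fin N := ⟨w (i + 1) - 1, by have := hbounds i; omega⟩
  have hf : Function.Injective f := by
    intro i j hij
    have hletter : w (i + 1) - 1 = w (j + 1) - 1 := congrArg Fin.val hij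
    have hplace := hw.injOn (hmem i) (hmem j) (by have := hbounds i; have := hbounds j; omega)
    exact Fin.ext (Nat.succ.inj hplace)
  refine ⟨Equiv.ofBijective f (Finite.injective_iff_bijective.1 hf), ?_⟩
  funext i
  by_cases hi : i ∈ Icc 1 N
  · rw [oneLine_of_mem _ hi, Equiv.ofBijective_apply]
    have hpos := mem_Icc.1 (hw.apply_mem hi)
    simp only [f, Nat.sub_add_cancel (mem_Icc.1 hi).1, Nat.sub_add_cancel hpos.1]
  · rw [(isWord_oneLine _).eq_zero i hi, hw.eq_zero i hi]

end OneLine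

section Excedances

variable {g k ℓ N i e : ℕ} {w : ℕ → ℕ}

lemma mem_Excp : i ∈ Excp g ℓ N w ↔ i ∈ Icc 1 N ∧ i + g ≤ w i ∧ ℓ ≤ w i := mem_filter

lemma mem_Nexcp : i ∈ Nexcp g ℓ N w ↔ i ∈ Icc 1 N ∧ i ∉ Excp g ℓ N w := mem_sdiff

lemma Excp_subset : Excp g ℓ N w ⊆ Icc 1 N := filter_subset _ _

lemma Nexcp_subset : Nexcp g ℓ N w ⊆ Icc 1 N := sdiff_subset

lemma mem_Excl : e ∈ Excl g ℓ N w ↔ ∃ i ∈ Excp g ℓ N w, w i = e := mem_image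

lemma apply_mem_Excl (hi : i ∈ Excp g ℓ N w) : w i ∈ Excl g ℓ N w := mem_image_of_mem w hi

lemma Excp_subset_of_gap_le (hk : k ≤ g) : Excp g ℓ N w ⊆ Excp k ℓ N w :=
  monotone_filter_right _ fun _ _ h => ⟨by omega, h.2⟩

lemma Excl_subset_of_gap_le (hk : k ≤ g) : Excl g ℓ N w ⊆ Excl k ℓ N w :=
  image_subset_image (Excp_subset_of_gap_le hk)

lemma IsWord.apply_mem_Excl_iff (hw : IsWord N w) (hi : i ∈ Icc 1 N) :
    w i ∈ Excl g ℓ N w ↔ i ∈ Excp g ℓ N w := by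
  refine ⟨fun h => ?_, apply_mem_Excl⟩
  obtain ⟨j, hj, hji⟩ := mem_Excl.1 h
  exact hw.injOn (Excp_subset hj) hi hji ▸ hj

lemma IsWord.Excl_subset (hw : IsWord N w) : Excl g ℓ N w ⊆ Icc ℓ N := by
  intro e he
  obtain ⟨i, hi, rfl⟩ := mem_Excl.1 he
  have hi := mem_Excp.1 hi
  exact mem_Icc.2 ⟨hi.2.2, (mem_Icc.1 (hw.apply_mem hi.1)).2⟩

lemma IsWord.card_filter_Excp (hw : IsWord N w) (p : ℕ → Prop) [DecidablePred p] :
    #{i ∈ Excp g ℓ N w | p (w i)} = #{e ∈ Excl g ℓ N w | p e} := by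
  rw [Excl, filter_image, card_image_of_injOn]
  exact hw.injOn.mono fun i hi => Excp_subset (mem_filter.1 hi).1

lemma IsWord.card_Excp (hw : IsWord N w) : #(Excp g ℓ N w) = #(Excl g ℓ N w) :=
  (card_image_of_injOn (hw.injOn.mono Excp_subset)).symm

lemma card_filter_Excp_add_card_filter_Nexcp (p : ℕ → Prop) [DecidablePred p] :
    #{i ∈ Excp g ℓ N w | p i} + #{i ∈ Nexcp g ℓ N w | p i} = #{i ∈ Icc 1 N | p i} := by
  rw [Nexcp, ← card_union_of_disjoint (disjoint_filter_filter disjoint_sdiff), ← filter_union,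
    union_sdiff_of_subset Excp_subset]

lemma IsWord.card_filter_lt_apply (hw : IsWord N w) (a : ℕ) : #{i ∈ Icc 1 N | a < w i} = N - a := by
  rw [← card_image_of_injOn (hw.injOn.mono (filter_subset _ _)), ← filter_image (p := (a < ·)),
    hw.image_eq]
  have hIcc : {z ∈ Icc 1 N | a < z} = Icc (a + 1) N := by grind
  rw [hIcc, Nat.card_Icc, Nat.add_sub_add_right]

/-- A letter at a place `≥ ℓ` that exceeds its place by `g` is `≥ g + ℓ`, so the two conventions
for the level agree. -/
lemma exc_eq_card (w : ℕ → ℕ) : exc g ℓ N w = #{i ∈ Excp g (g + ℓ) N w | ℓ ≤ i} := by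
  refine congrArg card (Finset.ext fun i => ?_)
  simp only [mem_filter, mem_Excp]
  grind

end Excedances

section Inversions

variable {v w : ℕ → ℕ} {S U : Finset ℕ} {x : ℕ}

lemma invOn_image {θ P : ℕ → ℕ} (hP : StrictMonoOn P S)
    (h : ∀ i ∈ S, ∀ j ∈ S, θ (P i) < θ (P j) ↔ w i < w j) :
    invOn θ (S.image P) = invOn w S := by
  have hinj : Set.InjOn (Prod.map P P) ↑(S ×ˢ S) := by
    rw [coe_product]
    exact hP.injOn.prodMap hP.injOn
  rw [invOn, ← prodMap_image_product, filter_image,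
    card_image_of_injOn (hinj.mono (filter_subset _ _)), invOn]
  refine congrArg card (filter_congr fun p hp => ?_)
  rw [mem_product] at hp
  exact and_congr (hP.lt_iff_lt hp.1 hp.2) (h _ hp.2 _ hp.1)

lemma invOn_congr (h : ∀ i ∈ S, v i = w i) : invOn v S = invOn w S := by
  refine congrArg card (filter_congr fun p hp => ?_)
  rw [mem_product] at hp
  rw [h _ hp.1, h _ hp.2]

lemma invOn_eq_sum (w : ℕ → ℕ) (S : Finset ℕ) :
    invOn w S = ∑ j ∈ S, #{i ∈ S | i < j ∧ w j < w i} := by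
  simp only [invOn, card_filter, sum_product_right]

lemma invOn_insert (hx : x ∉ S) :
    invOn w (insert x S) =
      invOn w S + #{i ∈ S | i < x ∧ w x < w i} + #{i ∈ S | x < i ∧ w i < w x} := by
  have hcol (j : ℕ) : #{i ∈ insert x S | i < j ∧ w j < w i} =
      #{i ∈ S | i < j ∧ w j < w i} + if x < j ∧ w j < w x then 1 else 0 := by
    rw [filter_insert]
    split_ifs with h
    · exact card_insert_of_notMem fun hmem => hx (mem_filter.1 hmem).1
    · rfl
  rw [invOn_eq_sum, invOn_eq_sum, sum_insert hx, sum_congr rfl fun j _ => hcol j, hcol x,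
    sum_add_distrib, ← card_filter, if_neg fun h => lt_irrefl x h.1]
  ring

lemma invOn_union (hSU : ∀ i ∈ S, ∀ j ∈ U, i < j) (hw : Set.InjOn w S) :
    invOn w (S ∪ U) = invOn w S + invOn w U + ∑ j ∈ U, #{e ∈ S.image w | w j < e} := by
  have hdisj : Disjoint S U := disjoint_left.2 fun i hS hU => lt_irrefl i (hSU i hS i hU)
  have hsplit (j : ℕ) : #{i ∈ S ∪ U | i < j ∧ w j < w i} =
      #{i ∈ S | i < j ∧ w j < w i} + #{i ∈ U | i < j ∧ w j < w i} := by
    rw [filter_union, card_union_of_disjoint (disjoint_filter_filter hdisj)]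
  have hleft : ∀ j ∈ S, #{i ∈ U | i < j ∧ w j < w i} = 0 := fun j hj =>
    card_eq_zero.2 (filter_eq_empty_iff.2 fun i hi h => lt_asymm h.1 (hSU j hj i hi))
  have hcross : ∀ j ∈ U, #{i ∈ S | i < j ∧ w j < w i} = #{e ∈ S.image w | w j < e} := by
    intro j hj
    rw [filter_image, card_image_of_injOn (hw.mono (filter_subset _ _))]
    exact congrArg card (filter_congr fun i hi => and_iff_right (hSU i hi j hj))
  simp only [invOn_eq_sum, sum_union hdisj, hsplit, sum_add_distrib]
  rw [sum_eq_zero hleft, sum_congr rfl hcross]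
  ring

/-- Stated without subtraction: permuting the letters on the initial places `S` changes only the
inversions within `S`. -/
lemma invOn_union_add {θ : ℕ → ℕ} (hSU : ∀ i ∈ S, ∀ j ∈ U, i < j) (hU : ∀ j ∈ U, θ j = v j)
    (hS : S.image θ = S.image v) (hv : Set.InjOn v S) :
    invOn θ (S ∪ U) + invOn v S = invOn v (S ∪ U) + invOn θ S := by
  have hθ : Set.InjOn θ S := by
    refine injOn_of_card_image_eq ?_
    rw [hS, card_image_of_injOn hv]
  have hcross : ∑ j ∈ U, #{e ∈ S.image θ | θ j < e} = ∑ j ∈ U, #{e ∈ S.image v | v j < e} :=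
    sum_congr rfl fun j hj => by rw [hS, hU j hj]
  rw [invOn_union hSU hθ, invOn_union hSU hv, invOn_congr hU, hcross]
  ring

end Inversions

section NextElement

variable {α : Type*} [LinearOrder α] {S T : Finset α} {n a i j t z : α}

lemma min_untopD_mem_insert (S : Finset α) (n : α) : S.min.untopD n ∈ insert n S := by
  rcases S.eq_empty_or_nonempty with rfl | hS
  · exact mem_insert_self n ∅
  · obtain ⟨m, hm⟩ := min_of_nonempty hS
    rw [hm]
    exact mem_insert_of_mem (mem_of_min hm)

lemma min_untopD_le (n : α) (ht : t ∈ S) : S.min.untopD n ≤ t := by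
  obtain ⟨m, hm⟩ := min_of_mem ht
  rw [hm]
  exact min_le_of_eq ht hm

lemma max_unbotD_mem (hS : S.Nonempty) (n : α) : S.max.unbotD n ∈ S := by
  obtain ⟨m, hm⟩ := max_of_nonempty hS
  rw [hm]
  exact mem_of_max hm

lemma le_max_unbotD (n : α) (ht : t ∈ S) : t ≤ S.max.unbotD n := by
  obtain ⟨m, hm⟩ := max_of_mem ht
  rw [hm]
  exact le_max_of_eq ht hm

/-- The successor of `z` in the chain `T ∪ {n}`, where `n` is meant to lie above `T`: the smallest
element of `T` above `z`, and `n` if there is none. -/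
def nextIn (T : Finset α) (n z : α) : α := ({t ∈ T | z < t}).min.untopD n

lemma nextIn_mem_insert (T : Finset α) (n z : α) : nextIn T n z ∈ insert n T :=
  insert_subset_insert n (filter_subset _ T) (min_untopD_mem_insert {t ∈ T | z < t} n)

lemma lt_nextIn (T : Finset α) (hz : z < n) : z < nextIn T n z := by
  rcases mem_insert.1 (min_untopD_mem_insert {t ∈ T | z < t} n) with h | h
  · exact hz.trans_eq h.symm
  · exact (mem_filter.1 h).2

lemma nextIn_le (n : α) (ht : t ∈ T) (hz : z < t) : nextIn T n z ≤ t :=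
  min_untopD_le n (mem_filter.2 ⟨ht, hz⟩)

lemma le_of_mem_insert (hT : ∀ t ∈ T, t < n) (hz : z ∈ insert n T) : z ≤ n := by
  rcases mem_insert.1 hz with rfl | hz
  · exact le_rfl
  · exact (hT z hz).le

lemma nextIn_eq (hT : ∀ t ∈ T, t < n) (hj : j ∈ insert n T) (hz : z < j)
    (h : ∀ t ∈ T, z < t → j ≤ t) : nextIn T n z = j := by
  have hjn := le_of_mem_insert hT hj
  have hnext := nextIn_mem_insert T n z
  refine le_antisymm ?_ ?_
  · rcases mem_insert.1 hj with rfl | hj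
    · exact le_of_mem_insert hT hnext
    · exact nextIn_le n hj hz
  · rcases mem_insert.1 hnext with h' | h'
    · exact hjn.trans_eq h'.symm
    · exact h _ h' (lt_nextIn T (hz.trans_le hjn))

lemma max_filter_lt_nextIn (d : α) (hi : i ∈ S) (hin : i < n) :
    ({j ∈ S | j < nextIn S n i}).max.unbotD d = i := by
  have hmem : i ∈ ({j ∈ S | j < nextIn S n i} : Finset α) :=
    mem_filter.2 ⟨hi, lt_nextIn S hin⟩
  refine le_antisymm (le_of_not_gt fun hlt => ?_) (le_max_unbotD d hmem)
  have hmax := mem_filter.1 (max_unbotD_mem ⟨i, hmem⟩ d)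
  exact (nextIn_le n hmax.1 hlt).not_gt hmax.2

/-- With `t₁ < ⋯ < t_s` the elements of `T` and `t_{s+1} = n`, the map that sends every
`t_j ≥ a` to `t_{j+1}` and fixes everything else. It makes room for one more element at `a`. -/
def bump (T : Finset α) (n a z : α) : α := if z ∈ T ∧ a ≤ z then nextIn T n z else z

lemma bump_of_notMem (hz : z ∉ T) : bump T n a z = z := if_neg fun h => hz h.1

lemma bump_of_lt (hz : z < a) : bump T n a z = z := if_neg fun h => hz.not_ge h.2

lemma bump_of_le (hz : z ∈ T) (ha : a ≤ z) : bump T n a z = nextIn T n z := if_pos ⟨hz, ha⟩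

lemma bump_mem_insert (hz : z ∈ T) : bump T n a z ∈ insert n T := by
  unfold bump
  split_ifs
  · exact nextIn_mem_insert T n z
  · exact mem_insert_of_mem hz

lemma le_bump (hT : ∀ t ∈ T, t < n) : z ≤ bump T n a z := by
  unfold bump
  split_ifs with h
  · exact (lt_nextIn T (hT z h.1)).le
  · exact le_rfl

lemma bump_ne (ha : a ∈ insert n T) (hz : z < n) : bump T n a z ≠ a := by
  unfold bump
  split_ifs with h
  · exact (h.2.trans_lt (lt_nextIn T hz)).ne'
  · rintro rfl
    exact h ⟨mem_of_mem_insert_of_ne ha hz.ne, le_rfl⟩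

lemma strictMonoOn_bump {U : Set α} (hT : ∀ t ∈ T, t < n)
    (hU : ∀ y ∈ U, ∀ z ∈ U, y < z → y ∈ T → z ∈ T) : StrictMonoOn (bump T n a) U := by
  intro y hy z hz hyz
  by_cases hya : y ∈ T ∧ a ≤ y
  · have hzT := hU y hy z hz hyz hya.1
    rw [bump_of_le hya.1 hya.2, bump_of_le hzT (hya.2.trans hyz.le)]
    exact (nextIn_le n hzT hyz).trans_lt (lt_nextIn T (hT z hzT))
  · exact (if_neg hya).trans_lt (hyz.trans_le (le_bump hT))

lemma image_bump (hT : ∀ t ∈ T, t < n) (ha : a ∈ insert n T) :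
    T.image (bump T n a) = (insert n T).erase a := by
  have hn : n ∉ T := fun h => lt_irrefl n (hT n h)
  refine eq_of_subset_of_card_le (image_subset_iff.2 fun z hz =>
    mem_erase.2 ⟨bump_ne ha (hT z hz), bump_mem_insert hz⟩) ?_
  rw [card_image_of_injOn (strictMonoOn_bump hT fun _ _ _ hz _ _ => hz).injOn, card_erase_of_mem ha,
    card_insert_of_notMem hn, Nat.add_sub_cancel]

lemma image_bump_of_subset (hTS : T ⊆ S) (hS : ∀ s ∈ S, s < n) (ha : a ∈ insert n T) :
    S.image (bump T n a) = (insert n S).erase a := by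
  have hfix : (S \ T).image (bump T n a) = S \ T :=
    (image_congr fun z hz => bump_of_notMem (mem_sdiff.1 hz).2).trans image_id
  rw [← union_sdiff_of_subset hTS, image_union, hfix, image_bump (fun t ht => hS t (hTS ht)) ha]
  grind

lemma injOn_bump (hTS : T ⊆ S) (hS : ∀ s ∈ S, s < n) (ha : a ∈ insert n T) :
    Set.InjOn (bump T n a) S := by
  have hn : n ∉ S := fun h => lt_irrefl n (hS n h)
  refine injOn_of_card_image_eq ?_
  rw [image_bump_of_subset hTS hS ha, card_erase_of_mem (insert_subset_insert n hTS ha),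
    card_insert_of_notMem hn, Nat.add_sub_cancel]

end NextElement

lemma bump_of_Icc_subset {ℓ N x i : ℕ} {T : Finset ℕ} (hT : ∀ t ∈ T, t < N + 1)
    (hIcc : Icc ℓ N ⊆ T) (hi : i ∈ Icc ℓ N) :
    bump T (N + 1) x i = if x ≤ i then i + 1 else i := by
  obtain ⟨hil, hiN⟩ := mem_Icc.1 hi
  split_ifs with hx
  · rw [bump_of_le (hIcc hi) hx]
    refine nextIn_eq hT ?_ (Nat.lt_succ_self i) fun t _ ht => ht
    rcases hiN.eq_or_lt with rfl | hiN
    · exact mem_insert_self _ _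
    · exact mem_insert_of_mem (hIcc (mem_Icc.2 ⟨hil.trans (Nat.le_succ i), hiN⟩))
  · exact bump_of_lt (not_le.1 hx)

/-- The word `θ` arises from the word `w` of length `N` by making room for a place `x` (bumping
the places in `T`) and for a letter `a` (bumping the excedance letters), and by putting the letter
`a` at the place `x`. Each of the maps `α` and `δ`, and `β*` up to the final rotation, is of this
form. The set `T` holds all places `≥ ℓ`; left of `ℓ`, its form is restricted only by the
requirement that the excedance places and the other places keep their order. -/
structure IsInsertion (g ℓ N : ℕ) (w : ℕ → ℕ) (T : Finset ℕ) (x a : ℕ) (θ : ℕ → ℕ) : Prop where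
  gap_pos : 1 ≤ g
  level_pos : 1 ≤ ℓ
  le_succ : g + ℓ ≤ N + 1
  word : IsWord N w
  subset : T ⊆ Icc 1 N
  Icc_subset : Icc ℓ N ⊆ T
  place_mem : x ∈ insert (N + 1) T
  letter_mem : a ∈ insert (N + 1) (Excl g (g + ℓ) N w)
  letter_le : ∀ i ∈ Excp g (g + ℓ) N w, ℓ ≤ i → x ≤ i → a ≤ w i
  strictMonoOn_Excp : StrictMonoOn (bump T (N + 1) x) (Excp g (g + ℓ) N w)
  strictMonoOn_Nexcp : StrictMonoOn (bump T (N + 1) x) (Nexcp g (g + ℓ) N w)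
  apply_place : θ x = a
  apply_bump : ∀ i ∈ Icc 1 N, θ (bump T (N + 1) x i) = raise g ℓ (N + 1) w a i
  eq_zero : ∀ i ∉ Icc 1 (N + 1), θ i = 0

lemma raise_eq_bump {g ℓ N : ℕ} (w : ℕ → ℕ) (a i : ℕ) :
    raise g ℓ (N + 1) w a i = bump (Excl g (g + ℓ) N w) (N + 1) a (w i) := rfl

lemma lt_succ_of_mem_Icc {i N : ℕ} (hi : i ∈ Icc 1 N) : i < N + 1 :=
  Nat.lt_succ_of_le (mem_Icc.1 hi).2

namespace IsInsertion

variable {g ℓ N x a i p : ℕ} {w θ : ℕ → ℕ} {T S : Finset ℕ}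

section Bump

variable (h : IsInsertion g ℓ N w T x a θ)
include h

lemma place_lt : ∀ i ∈ T, i < N + 1 := fun _ hi => lt_succ_of_mem_Icc (h.subset hi)

lemma Excl_subset : Excl g (g + ℓ) N w ⊆ Icc 1 N :=
  h.word.Excl_subset.trans (Icc_subset_Icc_left (Nat.le_add_right_of_le h.gap_pos))

lemma letter_lt : ∀ e ∈ Excl g (g + ℓ) N w, e < N + 1 :=
  fun _ he => lt_succ_of_mem_Icc (h.Excl_subset he)

lemma place_mem_Icc : x ∈ Icc 1 (N + 1) := by
  have := h.subset
  have := h.place_mem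
  grind

lemma letter_mem_Icc : a ∈ Icc (g + ℓ) (N + 1) := by
  have := h.word.Excl_subset (g := g) (ℓ := g + ℓ)
  have := h.letter_mem
  have := h.le_succ
  grind

lemma image_bump_place : (Icc 1 N).image (bump T (N + 1) x) = (Icc 1 (N + 1)).erase x := by
  rw [image_bump_of_subset h.subset (fun _ => lt_succ_of_mem_Icc) h.place_mem,
    insert_Icc_right_eq_Icc_add_one (by omega)]

lemma injOn_bump_place : Set.InjOn (bump T (N + 1) x) (Icc 1 N : Finset ℕ) :=
  injOn_bump h.subset (fun _ => lt_succ_of_mem_Icc) h.place_mem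

lemma bump_place_mem (hi : i ∈ Icc 1 N) : bump T (N + 1) x i ∈ (Icc 1 (N + 1)).erase x :=
  h.image_bump_place ▸ mem_image_of_mem _ hi

lemma exists_bump_place_eq (hp : p ∈ Icc 1 (N + 1)) (hpx : p ≠ x) :
    ∃ i ∈ Icc 1 N, bump T (N + 1) x i = p :=
  mem_image.1 (h.image_bump_place ▸ mem_erase.2 ⟨hpx, hp⟩)

lemma le_raise (i : ℕ) : w i ≤ raise g ℓ (N + 1) w a i := le_bump h.letter_lt

lemma image_raise : (Icc 1 N).image (raise g ℓ (N + 1) w a) = (Icc 1 (N + 1)).erase a :=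
  calc (Icc 1 N).image (raise g ℓ (N + 1) w a)
      = ((Icc 1 N).image w).image (bump (Excl g (g + ℓ) N w) (N + 1) a) := by
        rw [image_image]
        rfl
    _ = (insert (N + 1) (Icc 1 N)).erase a := by
      rw [h.word.image_eq, image_bump_of_subset h.Excl_subset (fun _ => lt_succ_of_mem_Icc)
        h.letter_mem]
    _ = (Icc 1 (N + 1)).erase a := by rw [insert_Icc_right_eq_Icc_add_one (by omega)]

lemma isWord : IsWord (N + 1) θ where
  image_eq := by
    have hletter : a ∈ Icc 1 (N + 1) :=
      Icc_subset_Icc_left (Nat.le_add_right_of_le h.gap_pos) h.letter_mem_Icc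
    have herase : ((Icc 1 (N + 1)).erase x).image θ = (Icc 1 (N + 1)).erase a := by
      rw [← h.image_bump_place, image_image, ← h.image_raise]
      exact image_congr h.apply_bump
    rw [← insert_erase h.place_mem_Icc, image_insert, h.apply_place, herase,
      insert_erase hletter, insert_erase h.place_mem_Icc]
  eq_zero := h.eq_zero

lemma bump_of_level_le (hi : ℓ ≤ i) (hN : i ≤ N) :
    bump T (N + 1) x i = if x ≤ i then i + 1 else i :=
  bump_of_Icc_subset h.place_lt h.Icc_subset (mem_Icc.2 ⟨hi, hN⟩)

lemma bump_le_level (hi : i < ℓ) : bump T (N + 1) x i ≤ ℓ := by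
  have hgap := h.gap_pos
  have hlevel : ℓ ∈ T := h.Icc_subset (mem_Icc.2 ⟨le_rfl, by have := h.le_succ; omega⟩)
  unfold bump
  split_ifs
  · exact nextIn_le _ hlevel hi
  · exact hi.le

end Bump

section Excedances

variable (h : IsInsertion g ℓ N w T x a θ)
include h

lemma apply_bump_of_mem_Excp (hi : i ∈ Excp g (g + ℓ) N w) :
    bump T (N + 1) x i + g ≤ θ (bump T (N + 1) x i) ∧ g + ℓ ≤ θ (bump T (N + 1) x i) := by
  obtain ⟨hiN, hgap, hlevel⟩ := mem_Excp.1 hi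
  have hraise := h.le_raise i
  rw [h.apply_bump i hiN]
  refine ⟨?_, hlevel.trans hraise⟩
  rcases lt_or_ge i ℓ with hil | hil
  · have := h.bump_le_level hil
    omega
  · rw [h.bump_of_level_le hil (mem_Icc.1 hiN).2]
    split_ifs with hx
    · have hE : w i ∈ Excl g (g + ℓ) N w := apply_mem_Excl hi
      rw [raise_eq_bump, bump_of_le hE (h.letter_le i hi hil hx)]
      have := lt_nextIn (Excl g (g + ℓ) N w) (h.letter_lt _ hE)
      omega
    · omega

lemma apply_bump_of_mem_Nexcp (hi : i ∈ Nexcp g (g + ℓ) N w) : θ (bump T (N + 1) x i) = w i := by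
  rw [mem_Nexcp] at hi
  rw [h.apply_bump i hi.1, raise_eq_bump, bump_of_notMem]
  exact (h.word.apply_mem_Excl_iff hi.1).not.2 hi.2

lemma bump_mem_Excp (hi : i ∈ Icc 1 N) :
    bump T (N + 1) x i ∈ Excp g (g + ℓ) (N + 1) θ ↔ i ∈ Excp g (g + ℓ) N w := by
  refine ⟨fun hP => ?_, fun hX =>
    mem_Excp.2 ⟨mem_of_mem_erase (h.bump_place_mem hi), h.apply_bump_of_mem_Excp hX⟩⟩
  by_contra hX
  rw [mem_Excp, h.apply_bump_of_mem_Nexcp (mem_Nexcp.2 ⟨hi, hX⟩)] at hP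
  have hle : i ≤ bump T (N + 1) x i := le_bump h.place_lt
  exact hX (mem_Excp.2 ⟨hi, by omega, hP.2.2⟩)

lemma bump_mem_Nexcp (hi : i ∈ Icc 1 N) :
    bump T (N + 1) x i ∈ Nexcp g (g + ℓ) (N + 1) θ ↔ i ∈ Nexcp g (g + ℓ) N w := by
  rw [mem_Nexcp, mem_Nexcp, h.bump_mem_Excp hi]
  exact and_congr_left' (iff_of_true (mem_of_mem_erase (h.bump_place_mem hi)) hi)

lemma place_mem_Excp : x ∈ Excp g (g + ℓ) (N + 1) θ ↔ x + g ≤ a := by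
  rw [mem_Excp, h.apply_place, and_iff_right h.place_mem_Icc,
    and_iff_left (mem_Icc.1 h.letter_mem_Icc).1]

lemma erase_place_eq_image {U : Finset ℕ} (hU : U ⊆ Icc 1 (N + 1)) (hS : S ⊆ Icc 1 N)
    (hSU : ∀ i ∈ Icc 1 N, bump T (N + 1) x i ∈ U ↔ i ∈ S) :
    U.erase x = S.image (bump T (N + 1) x) := by
  ext p
  rw [mem_erase, mem_image]
  constructor
  · rintro ⟨hpx, hp⟩
    obtain ⟨i, hi, rfl⟩ := h.exists_bump_place_eq (hU hp) hpx
    exact ⟨i, (hSU i hi).1 hp, rfl⟩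
  · rintro ⟨i, hi, rfl⟩
    exact ⟨ne_of_mem_erase (h.bump_place_mem (hS hi)), (hSU i (hS hi)).2 hi⟩

lemma erase_place_Excp : (Excp g (g + ℓ) (N + 1) θ).erase x =
    (Excp g (g + ℓ) N w).image (bump T (N + 1) x) :=
  h.erase_place_eq_image Excp_subset Excp_subset fun _ => h.bump_mem_Excp

lemma erase_place_Nexcp : (Nexcp g (g + ℓ) (N + 1) θ).erase x =
    (Nexcp g (g + ℓ) N w).image (bump T (N + 1) x) :=
  h.erase_place_eq_image Nexcp_subset Nexcp_subset fun _ => h.bump_mem_Nexcp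

lemma Excp_eq_of_le (hx : x + g ≤ a) : Excp g (g + ℓ) (N + 1) θ =
    insert x ((Excp g (g + ℓ) N w).image (bump T (N + 1) x)) := by
  rw [← h.erase_place_Excp, insert_erase (h.place_mem_Excp.2 hx)]

lemma Nexcp_eq_of_le (hx : x + g ≤ a) :
    Nexcp g (g + ℓ) (N + 1) θ = (Nexcp g (g + ℓ) N w).image (bump T (N + 1) x) := by
  rw [← h.erase_place_Nexcp, erase_eq_of_notMem]
  exact fun hc => (mem_Nexcp.1 hc).2 (h.place_mem_Excp.2 hx)

lemma Excp_eq_of_lt (hx : a < x + g) :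
    Excp g (g + ℓ) (N + 1) θ = (Excp g (g + ℓ) N w).image (bump T (N + 1) x) := by
  rw [← h.erase_place_Excp, erase_eq_of_notMem]
  exact fun hc => hx.not_ge (h.place_mem_Excp.1 hc)

lemma Nexcp_eq_of_lt (hx : a < x + g) : Nexcp g (g + ℓ) (N + 1) θ =
    insert x ((Nexcp g (g + ℓ) N w).image (bump T (N + 1) x)) := by
  rw [← h.erase_place_Nexcp, insert_erase]
  exact mem_Nexcp.2 ⟨h.place_mem_Icc, fun hc => hx.not_ge (h.place_mem_Excp.1 hc)⟩

lemma image_image_bump_Excp : ((Excp g (g + ℓ) N w).image (bump T (N + 1) x)).image θ =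
    (insert (N + 1) (Excl g (g + ℓ) N w)).erase a := by
  rw [← image_bump h.letter_lt h.letter_mem, image_image, Excl, image_image]
  exact image_congr fun i hi => h.apply_bump i (Excp_subset hi)

lemma Excl_eq_of_le (hx : x + g ≤ a) :
    Excl g (g + ℓ) (N + 1) θ = insert (N + 1) (Excl g (g + ℓ) N w) := by
  rw [Excl, h.Excp_eq_of_le hx, image_insert, h.image_image_bump_Excp, h.apply_place,
    insert_erase h.letter_mem]

lemma Excl_eq_of_lt (hx : a < x + g) :
    Excl g (g + ℓ) (N + 1) θ = (insert (N + 1) (Excl g (g + ℓ) N w)).erase a := by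
  rw [Excl, h.Excp_eq_of_lt hx, h.image_image_bump_Excp]

lemma Excl_eq :
    Excl g (g + ℓ) N w = (insert a (Excl g (g + ℓ) (N + 1) θ)).erase (N + 1) := by
  have hN : N + 1 ∉ Excl g (g + ℓ) N w := fun hc => lt_irrefl _ (h.letter_lt _ hc)
  rcases lt_or_ge a (x + g) with hx | hx
  · rw [h.Excl_eq_of_lt hx, insert_erase h.letter_mem, erase_insert hN]
  · rw [h.Excl_eq_of_le hx, insert_eq_of_mem h.letter_mem, erase_insert hN]

lemma word_unique {w' : ℕ → ℕ} (h' : IsInsertion g ℓ N w' T x a θ) : w = w' := by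
  funext i
  by_cases hi : i ∈ Icc 1 N
  · refine injOn_bump h.Excl_subset (fun _ => lt_succ_of_mem_Icc) h.letter_mem
      (h.word.apply_mem hi) (h'.word.apply_mem hi) ?_
    rw [← raise_eq_bump, ← h.apply_bump i hi, h'.apply_bump i hi, raise_eq_bump, h.Excl_eq,
      h'.Excl_eq]
  · rw [h.word.eq_zero i hi, h'.word.eq_zero i hi]

end Excedances

section Denert

variable (h : IsInsertion g ℓ N w T x a θ)
include h

lemma invOn_image_Excp :
    invOn θ ((Excp g (g + ℓ) N w).image (bump T (N + 1) x)) = invOn w (Excp g (g + ℓ) N w) := by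
  refine invOn_image h.strictMonoOn_Excp fun i hi j hj => ?_
  rw [h.apply_bump i (Excp_subset hi), h.apply_bump j (Excp_subset hj)]
  exact (strictMonoOn_bump h.letter_lt fun _ _ _ hz _ _ => hz).lt_iff_lt
    (apply_mem_Excl hi) (apply_mem_Excl hj)

lemma invOn_image_Nexcp :
    invOn θ ((Nexcp g (g + ℓ) N w).image (bump T (N + 1) x)) =
      invOn w (Nexcp g (g + ℓ) N w) := by
  refine invOn_image h.strictMonoOn_Nexcp fun i hi j hj => ?_
  rw [h.apply_bump_of_mem_Nexcp hi, h.apply_bump_of_mem_Nexcp hj]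

lemma place_notMem_image (hS : S ⊆ Icc 1 N) : x ∉ S.image (bump T (N + 1) x) := fun hc =>
  notMem_erase x _ (h.image_bump_place ▸ image_subset_image hS hc)

lemma sum_image_bump (hS : S ⊆ Icc 1 N) (f : ℕ → ℕ) :
    ∑ p ∈ S.image (bump T (N + 1) x), f p = ∑ i ∈ S, f (bump T (N + 1) x i) :=
  sum_image (h.injOn_bump_place.mono hS)

lemma card_filter_image_bump (hS : S ⊆ Icc 1 N) (p : ℕ → Prop) [DecidablePred p] :
    #{i ∈ S.image (bump T (N + 1) x) | p i} = #{i ∈ S | p (bump T (N + 1) x i)} := by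
  rw [card_filter, card_filter, h.sum_image_bump hS]

lemma den_of_le (hx : x + g ≤ a) :
    den g (g + ℓ) (N + 1) θ = (∑ i ∈ Excp g (g + ℓ) N w, (bump T (N + 1) x i + g - 1)) +
      (x + g - 1) + invOn w (Excp g (g + ℓ) N w) + invOn w (Nexcp g (g + ℓ) N w) +
      #{i ∈ Excp g (g + ℓ) N w | bump T (N + 1) x i < x ∧ a < raise g ℓ (N + 1) w a i} +
      #{i ∈ Excp g (g + ℓ) N w | x < bump T (N + 1) x i ∧ raise g ℓ (N + 1) w a i < a} := by
  have hraise (q : ℕ → ℕ → Prop) [∀ i j, Decidable (q i j)] :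
      #{i ∈ Excp g (g + ℓ) N w | q (bump T (N + 1) x i) (θ (bump T (N + 1) x i))} =
        #{i ∈ Excp g (g + ℓ) N w | q (bump T (N + 1) x i) (raise g ℓ (N + 1) w a i)} :=
    congrArg card (filter_congr fun i hi => by rw [h.apply_bump i (Excp_subset hi)])
  rw [den, h.Excp_eq_of_le hx, h.Nexcp_eq_of_le hx,
    invOn_insert (h.place_notMem_image Excp_subset), sum_insert (h.place_notMem_image Excp_subset),
    h.sum_image_bump Excp_subset, h.card_filter_image_bump Excp_subset,
    h.card_filter_image_bump Excp_subset, h.invOn_image_Excp, h.invOn_image_Nexcp, h.apply_place,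
    hraise (fun p z => p < x ∧ a < z), hraise (fun p z => x < p ∧ z < a)]
  ring

lemma den_of_lt (hx : a < x + g) :
    den g (g + ℓ) (N + 1) θ = (∑ i ∈ Excp g (g + ℓ) N w, (bump T (N + 1) x i + g - 1)) +
      invOn w (Excp g (g + ℓ) N w) + invOn w (Nexcp g (g + ℓ) N w) +
      #{i ∈ Nexcp g (g + ℓ) N w | bump T (N + 1) x i < x ∧ a < w i} +
      #{i ∈ Nexcp g (g + ℓ) N w | x < bump T (N + 1) x i ∧ w i < a} := by
  have hletter (q : ℕ → ℕ → Prop) [∀ i j, Decidable (q i j)] :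
      #{i ∈ Nexcp g (g + ℓ) N w | q (bump T (N + 1) x i) (θ (bump T (N + 1) x i))} =
        #{i ∈ Nexcp g (g + ℓ) N w | q (bump T (N + 1) x i) (w i)} :=
    congrArg card (filter_congr fun i hi => by rw [h.apply_bump_of_mem_Nexcp hi])
  rw [den, h.Excp_eq_of_lt hx, h.Nexcp_eq_of_lt hx,
    invOn_insert (h.place_notMem_image Nexcp_subset), h.sum_image_bump Excp_subset,
    h.card_filter_image_bump Nexcp_subset, h.card_filter_image_bump Nexcp_subset,
    h.invOn_image_Excp, h.invOn_image_Nexcp, h.apply_place,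
    hletter (fun p z => p < x ∧ a < z), hletter (fun p z => x < p ∧ z < a)]
  ring

end Denert

end IsInsertion

section Maps

variable {g ℓ N x i e : ℕ} {w : ℕ → ℕ} {S U : Finset ℕ}

lemma mem_setA (hw : IsWord N w) :
    i ∈ setA g ℓ (N + 1) w ↔ i ∈ Excp g (g + ℓ) N w ∧ i < ℓ := by
  rw [setA, mem_filter, Nat.add_sub_cancel, ← and_assoc, and_congr_left_iff]
  exact fun _ => ⟨fun h => (hw.apply_mem_Excl_iff h.1).1 h.2,
    fun h => ⟨Excp_subset h, apply_mem_Excl h⟩⟩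

lemma mem_setB (hw : IsWord N w) :
    i ∈ setB g ℓ (N + 1) w ↔ i ∈ Nexcp g (g + ℓ) N w ∧ i < ℓ := by
  rw [setB, mem_filter, Nat.add_sub_cancel, ← and_assoc, and_congr_left_iff, mem_Nexcp]
  exact fun _ => and_congr_right fun h => (hw.apply_mem_Excl_iff h).not

lemma insertionLetter_mem (x : ℕ) :
    insertionLetter g ℓ (N + 1) w x ∈ insert (N + 1) (Excl g (g + ℓ) N w) :=
  insert_subset_insert _ (filter_subset _ _) (min_untopD_mem_insert _ _)

lemma min_le_insertionLetter (x : ℕ) :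
    min (x + (g - 1)) (N + 1) ≤ insertionLetter g ℓ (N + 1) w x := by
  have := min_untopD_mem_insert ({e ∈ Excl g (g + ℓ) N w | x + (g - 1) ≤ e}) (N + 1)
  rw [mem_insert, mem_filter] at this
  exact min_le_iff.2 (this.symm.imp And.right ge_of_eq)

lemma insertionLetter_le (he : e ∈ Excl g (g + ℓ) N w) (hx : x + (g - 1) ≤ e) :
    insertionLetter g ℓ (N + 1) w x ≤ e :=
  min_untopD_le (N + 1) (mem_filter.2 ⟨he, hx⟩)

lemma firstLetter_mem : firstLetter g ℓ (N + 1) w ∈ insert (N + 1) (Excl g (g + ℓ) N w) :=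
  min_untopD_mem_insert (Excl g (g + ℓ) N w) (N + 1)

lemma firstLetter_le (he : e ∈ Excl g (g + ℓ) N w) : firstLetter g ℓ (N + 1) w ≤ e :=
  min_untopD_le (N + 1) he

lemma raise_firstLetter :
    raise g ℓ (N + 1) w (firstLetter g ℓ (N + 1) w) = raise g ℓ (N + 1) w 0 := by
  funext i
  by_cases hi : w i ∈ Excl g (g + ℓ) N w
  · rw [raise_eq_bump, raise_eq_bump, bump_of_le hi (firstLetter_le hi),
      bump_of_le hi (Nat.zero_le _)]
  · rw [raise_eq_bump, raise_eq_bump, bump_of_notMem hi, bump_of_notMem hi]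

lemma raise_eq_zero (hw : IsWord N w) (a : ℕ) (hi : i ∉ Icc 1 N) :
    raise g ℓ (N + 1) w a i = 0 := by
  rw [raise_eq_bump, hw.eq_zero i hi, bump_of_notMem]
  intro h
  obtain ⟨j, hj, hj0⟩ := mem_Excl.1 h
  have := mem_Icc.1 (hw.apply_mem (Excp_subset hj))
  omega

lemma isInsertion_delta (hg : 1 ≤ g) (hℓ : 1 ≤ ℓ) (hn : g + ℓ ≤ N + 1) (hw : IsWord N w)
    (hx : x ∈ Icc ℓ (N + 1)) :
    IsInsertion g ℓ N w (Icc ℓ N) x (insertionLetter g ℓ (N + 1) w x)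
      (insertBefore (raise g ℓ (N + 1) w (insertionLetter g ℓ (N + 1) w x)) x
        (insertionLetter g ℓ (N + 1) w x)) := by
  obtain ⟨hℓx, hxN⟩ := mem_Icc.1 hx
  have hlt : ∀ t ∈ Icc ℓ N, t < N + 1 := fun t ht => Nat.lt_succ_of_le (mem_Icc.1 ht).2
  have hmono {U : Finset ℕ} (hU : U ⊆ Icc 1 N) : StrictMonoOn (bump (Icc ℓ N) (N + 1) x) U :=
    strictMonoOn_bump hlt fun y _ z hz hyz hy =>
      mem_Icc.2 ⟨(mem_Icc.1 hy).1.trans hyz.le, (mem_Icc.1 (hU hz)).2⟩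
  exact
  { gap_pos := hg
    level_pos := hℓ
    le_succ := hn
    word := hw
    subset := Icc_subset_Icc_left hℓ
    Icc_subset := Subset.rfl
    place_mem := by rwa [insert_Icc_right_eq_Icc_add_one (by omega)]
    letter_mem := insertionLetter_mem x
    letter_le := fun i hi _ hxi => insertionLetter_le (apply_mem_Excl hi) <| by
      have := mem_Excp.1 hi
      omega
    strictMonoOn_Excp := hmono Excp_subset
    strictMonoOn_Nexcp := hmono Nexcp_subset
    apply_place := by rw [insertBefore, if_neg (lt_irrefl x), if_pos rfl]
    apply_bump := fun i hi => by
      rcases lt_or_ge i x with hix | hix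
      · rw [bump_of_lt hix, insertBefore, if_pos hix]
      · rw [bump_of_Icc_subset hlt Subset.rfl (mem_Icc.2 ⟨hℓx.trans hix, (mem_Icc.1 hi).2⟩),
          if_pos hix, insertBefore, if_neg (by omega), if_neg (by omega), Nat.add_sub_cancel]
    eq_zero := fun i hi => by
      rw [mem_Icc] at hi
      rw [insertBefore]
      split_ifs
      · exact raise_eq_zero hw _ (by rw [mem_Icc]; omega)
      · omega
      · exact raise_eq_zero hw _ (by rw [mem_Icc]; omega) }

lemma bump_union_Icc_of_lt (hS : S ⊆ Ico 1 ℓ) (hN : ℓ ≤ N) (hi : i < ℓ) :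
    bump (S ∪ Icc ℓ N) (N + 1) x i = bump S ℓ x i := by
  have hlt : ∀ t ∈ S ∪ Icc ℓ N, t < N + 1 := by grind
  have hnext : nextIn (S ∪ Icc ℓ N) (N + 1) i = nextIn S ℓ i := by
    have hmem := nextIn_mem_insert S ℓ i
    have hle : nextIn S ℓ i ≤ ℓ := le_of_mem_insert (fun t ht => (mem_Ico.1 (hS ht)).2) hmem
    refine nextIn_eq hlt ?_ (lt_nextIn S hi) fun t ht hit => ?_
    · rcases mem_insert.1 hmem with h | h
      · rw [h]
        exact mem_insert_of_mem (mem_union_right _ (mem_Icc.2 ⟨le_rfl, hN⟩))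
      · exact mem_insert_of_mem (mem_union_left _ h)
    · rcases mem_union.1 ht with ht | ht
      · exact nextIn_le ℓ ht hit
      · exact hle.trans (mem_Icc.1 ht).1
  by_cases hiS : i ∈ S ∧ x ≤ i
  · rw [bump_of_le (mem_union_left _ hiS.1) hiS.2, bump_of_le hiS.1 hiS.2, hnext]
  · have hiT : ¬ (i ∈ S ∪ Icc ℓ N ∧ x ≤ i) := by grind
    rw [bump, if_neg hiT, bump, if_neg hiS]

lemma shiftInsert_bump_of_lt (hS : S ⊆ Ico 1 ℓ) (hx : x ∈ S) (a : ℕ) (v : ℕ → ℕ) (hi : i < ℓ) :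
    shiftInsert ℓ S x a v (bump S ℓ x i) = v i := by
  by_cases hiS : i ∈ S ∧ x ≤ i
  · have hmax := max_filter_lt_nextIn (n := ℓ) 0 hiS.1 hi
    have hlt := lt_nextIn S hi
    rw [bump_of_le hiS.1 hiS.2, shiftInsert, insertBefore]
    rcases mem_insert.1 (nextIn_mem_insert S ℓ i) with hnext | hnext
    · rw [hnext, filter_true_of_mem fun j hj => (mem_Ico.1 (hS hj)).2] at hmax
      rw [hnext, if_neg (lt_irrefl ℓ), if_pos rfl, hmax]
    · rw [if_pos (mem_Ico.1 (hS hnext)).2, if_neg (by omega), if_pos ⟨hnext, by omega⟩, hmax]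
  · have hix : i ≠ x := by rintro rfl; exact hiS ⟨hx, le_rfl⟩
    rw [bump, if_neg hiS, shiftInsert, insertBefore, if_pos hi, if_neg hix,
      if_neg fun h => hiS ⟨h.1, h.2.le⟩]

lemma shiftInsert_of_gt (hS : S ⊆ Ico 1 ℓ) (hx : x ∈ S) (a : ℕ) (v : ℕ → ℕ) (hi : ℓ < i) :
    shiftInsert ℓ S x a v i = v (i - 1) := by
  have hxℓ := (mem_Ico.1 (hS hx)).2
  have hiS : i - 1 ∉ S := fun h => by
    have := mem_Ico.1 (hS h)
    omega
  rw [shiftInsert, insertBefore, if_neg hi.not_gt, if_neg hi.ne', if_neg (by omega),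
    if_neg fun h => hiS h.1]

lemma isInsertion_shiftInsert (hg : 1 ≤ g) (hn : g + ℓ ≤ N + 1) (hw : IsWord N w)
    (hS : S ⊆ Ico 1 ℓ) (hx : x ∈ S)
    (hX : StrictMonoOn (bump (S ∪ Icc ℓ N) (N + 1) x) (Excp g (g + ℓ) N w))
    (hY : StrictMonoOn (bump (S ∪ Icc ℓ N) (N + 1) x) (Nexcp g (g + ℓ) N w)) :
    IsInsertion g ℓ N w (S ∪ Icc ℓ N) x (firstLetter g ℓ (N + 1) w)
      (shiftInsert ℓ S x (firstLetter g ℓ (N + 1) w) (raise g ℓ (N + 1) w 0)) := by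
  obtain ⟨hx1, hxℓ⟩ := mem_Ico.1 (hS hx)
  exact
  { gap_pos := hg
    level_pos := by omega
    le_succ := hn
    word := hw
    subset := by grind
    Icc_subset := subset_union_right
    place_mem := mem_insert_of_mem (mem_union_left _ hx)
    letter_mem := firstLetter_mem
    letter_le := fun i hi _ _ => firstLetter_le (apply_mem_Excl hi)
    strictMonoOn_Excp := hX
    strictMonoOn_Nexcp := hY
    apply_place := by rw [shiftInsert, insertBefore, if_pos hxℓ, if_pos rfl]
    apply_bump := fun i hi => by
      rw [raise_firstLetter]
      rcases lt_or_ge i ℓ with hil | hil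
      · rw [bump_union_Icc_of_lt hS (by omega) hil, shiftInsert_bump_of_lt hS hx _ _ hil]
      · rw [bump_of_Icc_subset (by grind) subset_union_right
            (mem_Icc.2 ⟨hil, (mem_Icc.1 hi).2⟩), if_pos (by omega),
          shiftInsert_of_gt hS hx _ _ (by omega), Nat.add_sub_cancel]
    eq_zero := fun i hi => by
      rw [mem_Icc, not_and_or, not_le, not_le] at hi
      rcases hi with hi | hi
      · have hiS : i ∉ S := fun h => by
          have := mem_Ico.1 (hS h)
          omega
        rw [shiftInsert, insertBefore, if_pos (by omega), if_neg (by omega),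
          if_neg fun h => hiS h.1, raise_eq_zero hw _ (by rw [mem_Icc]; omega)]
      · rw [shiftInsert_of_gt hS hx _ _ (by omega), raise_eq_zero hw _ (by rw [mem_Icc]; omega)] }

lemma strictMonoOn_bump_union_Icc (hS : S ⊆ Ico 1 ℓ) (hN : ℓ ≤ N + 1) (hU : U ⊆ Icc 1 N)
    (hSU : {i ∈ U | i < ℓ} ⊆ S ∨ Disjoint S U) :
    StrictMonoOn (bump (S ∪ Icc ℓ N) (N + 1) x) U := by
  have hlt : ∀ t ∈ S ∪ Icc ℓ N, t < N + 1 := by grind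
  refine strictMonoOn_bump hlt fun y hy z hz hyz hyT => ?_
  have hzN := (mem_Icc.1 (hU hz)).2
  rcases lt_or_ge z ℓ with hzl | hzl
  · rcases hSU with hSU | hSU
    · exact mem_union_left _ (hSU (mem_filter.2 ⟨hz, hzl⟩))
    · rcases mem_union.1 hyT with hyS | hyl
      · exact absurd hy (disjoint_left.1 hSU hyS)
      · exact absurd (mem_Icc.1 hyl).1 (by omega)
  · exact mem_union_right _ (mem_Icc.2 ⟨hzl, hzN⟩)

lemma setA_subset (hw : IsWord N w) : setA g ℓ (N + 1) w ⊆ Ico 1 ℓ := fun i hi => by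
  rw [mem_setA hw] at hi
  exact mem_Ico.2 ⟨(mem_Icc.1 (Excp_subset hi.1)).1, hi.2⟩

lemma setB_subset (hw : IsWord N w) : setB g ℓ (N + 1) w ⊆ Ico 1 ℓ := fun i hi => by
  rw [mem_setB hw] at hi
  exact mem_Ico.2 ⟨(mem_Icc.1 (Nexcp_subset hi.1)).1, hi.2⟩

lemma setB_eq_sdiff (hw : IsWord N w) (hℓ : ℓ ≤ N + 1) :
    setB g ℓ (N + 1) w = Ico 1 ℓ \ setA g ℓ (N + 1) w := by
  ext i
  rw [mem_setB hw, mem_sdiff, mem_setA hw, mem_Nexcp, mem_Ico, mem_Icc]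
  grind

lemma isInsertion_setA (hg : 1 ≤ g) (hn : g + ℓ ≤ N + 1) (hw : IsWord N w)
    (hx : x ∈ setA g ℓ (N + 1) w) :
    IsInsertion g ℓ N w (setA g ℓ (N + 1) w ∪ Icc ℓ N) x (firstLetter g ℓ (N + 1) w)
      (shiftInsert ℓ (setA g ℓ (N + 1) w) x (firstLetter g ℓ (N + 1) w)
        (raise g ℓ (N + 1) w 0)) := by
  refine isInsertion_shiftInsert hg hn hw (setA_subset hw) hx
    (strictMonoOn_bump_union_Icc (setA_subset hw) (by omega) Excp_subset (Or.inl fun i hi => ?_))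
    (strictMonoOn_bump_union_Icc (setA_subset hw) (by omega) Nexcp_subset
      (Or.inr (disjoint_left.2 fun i hiA hi => ?_)))
  · exact (mem_setA hw).2 (mem_filter.1 hi)
  · exact (mem_Nexcp.1 hi).2 ((mem_setA hw).1 hiA).1

lemma isInsertion_setB (hg : 1 ≤ g) (hn : g + ℓ ≤ N + 1) (hw : IsWord N w)
    (hx : x ∈ setB g ℓ (N + 1) w) :
    IsInsertion g ℓ N w (setB g ℓ (N + 1) w ∪ Icc ℓ N) x (firstLetter g ℓ (N + 1) w)
      (shiftInsert ℓ (setB g ℓ (N + 1) w) x (firstLetter g ℓ (N + 1) w)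
        (raise g ℓ (N + 1) w 0)) := by
  refine isInsertion_shiftInsert hg hn hw (setB_subset hw) hx
    (strictMonoOn_bump_union_Icc (setB_subset hw) (by omega) Excp_subset
      (Or.inr (disjoint_left.2 fun i hiB hi => ?_)))
    (strictMonoOn_bump_union_Icc (setB_subset hw) (by omega) Nexcp_subset (Or.inl fun i hi => ?_))
  · exact (mem_Nexcp.1 ((mem_setB hw).1 hiB).1).2 hi
  · exact (mem_setB hw).2 (mem_filter.1 hi)

end Maps

section Rank

variable {α : Type*} [LinearOrder α]

lemma strictMonoOn_card_filter_lt (S : Finset α) : StrictMonoOn (fun x => #{j ∈ S | j < x}) S := by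
  refine fun x hx y _ hxy => card_lt_card (ssubset_iff_of_subset ?_ |>.2 ⟨x, ?_, ?_⟩)
  · exact monotone_filter_right S fun j _ hj => hj.trans hxy
  · exact mem_filter.2 ⟨hx, hxy⟩
  · exact fun hc => lt_irrefl x (mem_filter.1 hc).2

lemma strictAntiOn_card_filter_gt (S : Finset α) : StrictAntiOn (fun x => #{j ∈ S | x < j}) S := by
  refine fun x _ y hy hxy => card_lt_card (ssubset_iff_of_subset ?_ |>.2 ⟨y, ?_, ?_⟩)
  · exact monotone_filter_right S fun j _ hj => hxy.trans hj
  · exact mem_filter.2 ⟨hy, hxy⟩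
  · exact fun hc => lt_irrefl y (mem_filter.1 hc).2

end Rank

section Labels

variable {g ℓ N x c : ℕ} {w : ℕ → ℕ}

lemma setA_eq_filter (hw : IsWord N w) :
    setA g ℓ (N + 1) w = {i ∈ Excp g (g + ℓ) N w | i < ℓ} := by
  ext i
  rw [mem_setA hw, mem_filter]

lemma setB_eq_filter (hw : IsWord N w) :
    setB g ℓ (N + 1) w = {i ∈ Nexcp g (g + ℓ) N w | i < ℓ} := by
  ext i
  rw [mem_setB hw, mem_filter]

lemma filter_lt_setB (hw : IsWord N w) (hx : x ≤ ℓ) :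
    ({j ∈ setB g ℓ (N + 1) w | j < x} : Finset ℕ) = {i ∈ Nexcp g (g + ℓ) N w | i < x} := by
  rw [setB_eq_filter hw, filter_filter]
  exact filter_congr fun i _ => ⟨And.right, fun h => ⟨h.trans_le hx, h⟩⟩

lemma card_filter_lt_Excp_add_card_filter_lt_Nexcp (hx : x ≤ N + 1) :
    #{i ∈ Excp g ℓ N w | i < x} + #{i ∈ Nexcp g ℓ N w | i < x} = x - 1 := by
  rw [card_filter_Excp_add_card_filter_Nexcp, ← Nat.card_Ico 1 x]
  congr 1
  ext i
  rw [mem_filter, mem_Icc, mem_Ico]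
  omega

lemma card_setA_add_card_setB (hw : IsWord N w) (hn : ℓ ≤ N + 1) :
    #(setA g ℓ (N + 1) w) + #(setB g ℓ (N + 1) w) = ℓ - 1 := by
  rw [setA_eq_filter hw, setB_eq_filter hw, card_filter_lt_Excp_add_card_filter_lt_Nexcp hn]

lemma card_setA_add_exc (hw : IsWord N w) :
    #(setA g ℓ (N + 1) w) + exc g ℓ N w = #(Excl g (g + ℓ) N w) := by
  rw [exc_eq_card, ← hw.card_Excp, setA_eq_filter hw,
    ← card_filter_add_card_filter_not (s := Excp g (g + ℓ) N w) (· < ℓ)]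
  simp only [not_lt]

lemma notMem_Excl_of_lt (hw : IsWord N w) (hx : x < g + ℓ) : x ∉ Excl g (g + ℓ) N w := fun h =>
  hx.not_ge (mem_Icc.1 (hw.Excl_subset h)).1

lemma mem_remainingSpaces : x ∈ remainingSpaces g ℓ (N + 1) w ↔
    x ∈ Icc 1 (N + 1 - g) ∧ x + (g - 1) ∉ Excl g (g + ℓ) N w ∧ x ∉ setB g ℓ (N + 1) w :=
  mem_filter

lemma mem_remainingSpaces_of_lt (hg : 1 ≤ g) (hn : g + ℓ ≤ N + 1) (hw : IsWord N w) (hx : x < ℓ) :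
    x ∈ remainingSpaces g ℓ (N + 1) w ↔ x ∈ setA g ℓ (N + 1) w := by
  have hxE : x + (g - 1) ∉ Excl g (g + ℓ) N w := notMem_Excl_of_lt hw (by omega)
  rw [mem_remainingSpaces, mem_setA hw, mem_setB hw, mem_Nexcp, mem_Icc]
  constructor
  · rintro ⟨hxN, -, hxB⟩
    by_contra hxA
    exact hxB ⟨⟨mem_Icc.2 (by omega), fun hX => hxA ⟨hX, hx⟩⟩, hx⟩
  · rintro ⟨hX, -⟩
    have := mem_Icc.1 (Excp_subset hX)
    exact ⟨by omega, hxE, fun hB => hB.1.2 hX⟩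

lemma mem_remainingSpaces_of_le (hℓ : 1 ≤ ℓ) (hw : IsWord N w) (hx : ℓ ≤ x) :
    x ∈ remainingSpaces g ℓ (N + 1) w ↔ x ≤ N + 1 - g ∧ x + (g - 1) ∉ Excl g (g + ℓ) N w := by
  have hxB : x ∉ setB g ℓ (N + 1) w := fun h => hx.not_gt ((mem_setB hw).1 h).2
  rw [mem_remainingSpaces, mem_Icc, and_iff_left hxB, and_iff_right (hℓ.trans hx)]

lemma space_cases (hx : x ∈ Icc 1 (N + 1)) : N + 1 - g < x ∨ x + (g - 1) ∈ Excl g (g + ℓ) N w ∨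
    x ∈ setB g ℓ (N + 1) w ∨ x ∈ remainingSpaces g ℓ (N + 1) w := by
  rw [mem_remainingSpaces, mem_Icc]
  have := mem_Icc.1 hx
  by_contra! h
  exact h.2.2.1 (h.2.2.2 ⟨this.1, h.1⟩ h.2.1)

lemma label_of_lt (hx : N + 1 - g < x) : label g ℓ (N + 1) w x = N + 1 - x := if_pos hx

lemma label_of_mem_Excl (hw : IsWord N w) (hg : 1 ≤ g) (hx : x + (g - 1) ∈ Excl g (g + ℓ) N w) :
    label g ℓ (N + 1) w x = g + #{e ∈ Excl g (g + ℓ) N w | x + (g - 1) < e} := by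
  have := mem_Icc.1 (hw.Excl_subset hx)
  rw [label, if_neg (by omega), Nat.add_sub_cancel, if_pos hx]

lemma label_of_mem_setB (hg : 1 ≤ g) (hn : g + ℓ ≤ N + 1) (hw : IsWord N w)
    (hx : x ∈ setB g ℓ (N + 1) w) : label g ℓ (N + 1) w x =
      g + #(Excl g (g + ℓ) N w) + #{i ∈ Nexcp g (g + ℓ) N w | i < x} := by
  have hxℓ := ((mem_setB hw).1 hx).2
  rw [label, if_neg (by omega), Nat.add_sub_cancel, if_neg (notMem_Excl_of_lt hw (by omega)),
    if_pos hx, filter_lt_setB hw hxℓ.le]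

lemma label_of_mem_remainingSpaces (hx : x ∈ remainingSpaces g ℓ (N + 1) w) :
    label g ℓ (N + 1) w x = exc g ℓ N w + g + ℓ - 1 +
      #{j ∈ remainingSpaces g ℓ (N + 1) w | j < x} := by
  obtain ⟨hxN, hxE, hxB⟩ := mem_remainingSpaces.1 hx
  rw [label, if_neg (mem_Icc.1 hxN).2.not_gt, Nat.add_sub_cancel, if_neg hxE, if_neg hxB]

lemma label_of_mem_setA (hg : 1 ≤ g) (hn : g + ℓ ≤ N + 1) (hw : IsWord N w)
    (hx : x ∈ setA g ℓ (N + 1) w) : label g ℓ (N + 1) w x =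
      exc g ℓ N w + g + ℓ - 1 + #{i ∈ Excp g (g + ℓ) N w | i < x} := by
  have hxℓ := ((mem_setA hw).1 hx).2
  rw [label_of_mem_remainingSpaces ((mem_remainingSpaces_of_lt hg hn hw hxℓ).2 hx)]
  congr 2
  ext j
  rw [mem_filter, mem_filter, and_congr_left_iff]
  intro hj
  rw [mem_remainingSpaces_of_lt hg hn hw (hj.trans hxℓ), mem_setA hw,
    and_iff_left (hj.trans hxℓ)]

lemma card_filter_add_mem_Excl (hg : 1 ≤ g) (hw : IsWord N w) :
    #{j ∈ Ico ℓ x | j + (g - 1) ∈ Excl g (g + ℓ) N w} =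
      #{e ∈ Excl g (g + ℓ) N w | e < x + (g - 1)} := by
  refine card_bij (fun j _ => j + (g - 1)) (fun j hj => ?_) (fun _ _ _ _ h => by omega)
    fun e he => ?_
  · rw [mem_filter, mem_Ico] at hj
    exact mem_filter.2 ⟨hj.2, by omega⟩
  · rw [mem_filter] at he
    have := mem_Icc.1 (hw.Excl_subset he.1)
    refine ⟨e - (g - 1), mem_filter.2 ⟨mem_Ico.2 (by omega), ?_⟩, by omega⟩
    rw [Nat.sub_add_cancel (by omega)]
    exact he.1

lemma card_filter_lt_remainingSpaces (hg : 1 ≤ g) (hℓ : 1 ≤ ℓ) (hn : g + ℓ ≤ N + 1)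
    (hw : IsWord N w) (hx : ℓ ≤ x) (hxN : x ≤ N + 2 - g) :
    #{j ∈ remainingSpaces g ℓ (N + 1) w | j < x} +
      #{e ∈ Excl g (g + ℓ) N w | e < x + (g - 1)} = #(setA g ℓ (N + 1) w) + (x - ℓ) := by
  have hsplit : ({j ∈ remainingSpaces g ℓ (N + 1) w | j < x} : Finset ℕ) =
      setA g ℓ (N + 1) w ∪ {j ∈ Ico ℓ x | j + (g - 1) ∉ Excl g (g + ℓ) N w} := by
    ext j
    rw [mem_union, mem_filter, mem_filter, mem_Ico]
    rcases lt_or_ge j ℓ with hj | hj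
    · rw [mem_remainingSpaces_of_lt hg hn hw hj, and_iff_left (by omega),
        or_iff_left (by omega)]
    · have hjA : j ∉ setA g ℓ (N + 1) w := fun h => hj.not_gt ((mem_setA hw).1 h).2
      rw [mem_remainingSpaces_of_le hℓ hw hj, or_iff_right hjA, and_iff_right hj]
      exact ⟨fun h => ⟨h.2, h.1.2⟩, fun h => ⟨⟨by omega, h.2⟩, h.1⟩⟩
  have hdisj : Disjoint (setA g ℓ (N + 1) w)
      {j ∈ Ico ℓ x | j + (g - 1) ∉ Excl g (g + ℓ) N w} := disjoint_left.2 fun j hjA hj =>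
    (mem_Ico.1 (mem_filter.1 hj).1).1.not_gt ((mem_setA hw).1 hjA).2
  have hcompl := card_filter_add_card_filter_not (s := Ico ℓ x)
    (fun j => j + (g - 1) ∈ Excl g (g + ℓ) N w)
  rw [card_filter_add_mem_Excl hg hw, Nat.card_Ico] at hcompl
  rw [hsplit, card_union_of_disjoint hdisj]
  omega

lemma label_of_level_le (hg : 1 ≤ g) (hℓ : 1 ≤ ℓ) (hn : g + ℓ ≤ N + 1) (hw : IsWord N w)
    (hx : ℓ ≤ x) (hxN : x ≤ N + 1 - g) (hxE : x + (g - 1) ∉ Excl g (g + ℓ) N w) :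
    label g ℓ (N + 1) w x = x + (g - 1) + #{e ∈ Excl g (g + ℓ) N w | x + (g - 1) ≤ e} := by
  rw [label_of_mem_remainingSpaces ((mem_remainingSpaces_of_le hℓ hw hx).2 ⟨hxN, hxE⟩)]
  have hrank := card_filter_lt_remainingSpaces hg hℓ hn hw hx (by omega)
  have hA := card_setA_add_exc (g := g) (ℓ := ℓ) hw
  have hsplit := card_filter_add_card_filter_not (s := Excl g (g + ℓ) N w) (· < x + (g - 1))
  simp only [not_lt] at hsplit
  omega

lemma card_remainingSpaces (hg : 1 ≤ g) (hℓ : 1 ≤ ℓ) (hn : g + ℓ ≤ N + 1) (hw : IsWord N w) :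
    exc g ℓ N w + g + ℓ - 1 + #(remainingSpaces g ℓ (N + 1) w) = N + 1 := by
  have hrank := card_filter_lt_remainingSpaces (x := N + 2 - g) hg hℓ hn hw (by omega) le_rfl
  have hA := card_setA_add_exc (g := g) (ℓ := ℓ) hw
  rw [filter_true_of_mem fun j hj => by
      have := mem_Icc.1 (mem_remainingSpaces.1 hj).1
      omega,
    filter_true_of_mem fun e he => by
      have := mem_Icc.1 (hw.Excl_subset he)
      omega] at hrank
  omega

lemma label_lt_of_lt (hg : 1 ≤ g) (hx : N + 1 - g < x) : label g ℓ (N + 1) w x < g := by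
  rw [label_of_lt hx]
  omega

lemma label_mem_Ico_of_mem_Excl (hg : 1 ≤ g) (hw : IsWord N w)
    (hx : x + (g - 1) ∈ Excl g (g + ℓ) N w) :
    label g ℓ (N + 1) w x ∈ Ico g (g + #(Excl g (g + ℓ) N w)) := by
  rw [label_of_mem_Excl hw hg hx, mem_Ico]
  exact ⟨Nat.le_add_right _ _, Nat.add_lt_add_left
    (card_lt_card (filter_ssubset.2 ⟨_, hx, lt_irrefl _⟩)) g⟩

lemma label_mem_Ico_of_mem_setB (hg : 1 ≤ g) (hn : g + ℓ ≤ N + 1) (hw : IsWord N w)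
    (hx : x ∈ setB g ℓ (N + 1) w) : label g ℓ (N + 1) w x ∈
      Ico (g + #(Excl g (g + ℓ) N w)) (exc g ℓ N w + g + ℓ - 1) := by
  have hxℓ := ((mem_setB hw).1 hx).2
  have hrank : #{j ∈ setB g ℓ (N + 1) w | j < x} < #(setB g ℓ (N + 1) w) :=
    card_lt_card (filter_ssubset.2 ⟨x, hx, lt_irrefl x⟩)
  have hA := card_setA_add_exc (g := g) (ℓ := ℓ) hw
  have hAB := card_setA_add_card_setB (g := g) (ℓ := ℓ) hw (by omega)
  rw [filter_lt_setB hw hxℓ.le] at hrank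
  rw [label_of_mem_setB hg hn hw hx, mem_Ico]
  omega

lemma label_mem_Ico_of_mem_remainingSpaces (hg : 1 ≤ g) (hℓ : 1 ≤ ℓ) (hn : g + ℓ ≤ N + 1)
    (hw : IsWord N w) (hx : x ∈ remainingSpaces g ℓ (N + 1) w) :
    label g ℓ (N + 1) w x ∈ Ico (exc g ℓ N w + g + ℓ - 1) (N + 1) := by
  have hrank : #{j ∈ remainingSpaces g ℓ (N + 1) w | j < x} < #(remainingSpaces g ℓ (N + 1) w) :=
    card_lt_card (filter_ssubset.2 ⟨x, hx, lt_irrefl x⟩)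
  have hcard := card_remainingSpaces hg hℓ hn hw
  rw [label_of_mem_remainingSpaces hx, mem_Ico]
  omega

lemma card_Excl_lt (hℓ : 1 ≤ ℓ) (hn : ℓ ≤ N + 1) (hw : IsWord N w) :
    #(Excl g (g + ℓ) N w) < exc g ℓ N w + ℓ := by
  have hA := card_setA_add_exc (g := g) (ℓ := ℓ) hw
  have hAB := card_setA_add_card_setB (g := g) (ℓ := ℓ) hw hn
  omega

lemma mapsTo_label (hg : 1 ≤ g) (hℓ : 1 ≤ ℓ) (hn : g + ℓ ≤ N + 1) (hw : IsWord N w) :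
    Set.MapsTo (label g ℓ (N + 1) w) (Icc 1 (N + 1) : Finset ℕ) (range (N + 1) : Finset ℕ) := by
  intro x hx
  have hcard := card_remainingSpaces hg hℓ hn hw
  have hE := card_Excl_lt (g := g) hℓ (by omega : ℓ ≤ N + 1) hw
  refine mem_range.2 ?_
  rcases space_cases (g := g) (ℓ := ℓ) (w := w) hx with hlast | hxE | hxB | hxR
  · have := label_lt_of_lt (ℓ := ℓ) (w := w) hg hlast
    omega
  · have := mem_Ico.1 (label_mem_Ico_of_mem_Excl hg hw hxE)
    omega
  · have := mem_Ico.1 (label_mem_Ico_of_mem_setB hg hn hw hxB)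
    omega
  · exact (mem_Ico.1 (label_mem_Ico_of_mem_remainingSpaces hg hℓ hn hw hxR)).2

lemma injOn_label (hg : 1 ≤ g) (hℓ : 1 ≤ ℓ) (hn : g + ℓ ≤ N + 1) (hw : IsWord N w) :
    Set.InjOn (label g ℓ (N + 1) w) (Icc 1 (N + 1) : Finset ℕ) := by
  intro x hx y hy h
  have hE := card_Excl_lt (g := g) hℓ (by omega : ℓ ≤ N + 1) hw
  have hlast {z : ℕ} (hz : N + 1 - g < z) := label_lt_of_lt (ℓ := ℓ) (w := w) hg hz
  have hexc {z : ℕ} (hz : z + (g - 1) ∈ Excl g (g + ℓ) N w) :=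
    mem_Ico.1 (label_mem_Ico_of_mem_Excl hg hw hz)
  have hB {z : ℕ} (hz : z ∈ setB g ℓ (N + 1) w) :=
    mem_Ico.1 (label_mem_Ico_of_mem_setB hg hn hw hz)
  have hR {z : ℕ} (hz : z ∈ remainingSpaces g ℓ (N + 1) w) :=
    mem_Ico.1 (label_mem_Ico_of_mem_remainingSpaces hg hℓ hn hw hz)
  rcases space_cases (g := g) (ℓ := ℓ) (w := w) hx with hx' | hx' | hx' | hx' <;>
    rcases space_cases (g := g) (ℓ := ℓ) (w := w) hy with hy' | hy' | hy' | hy' <;>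
    first
    | (exfalso; grind)
    | skip
  · rw [label_of_lt hx', label_of_lt hy'] at h
    have := mem_Icc.1 hx
    have := mem_Icc.1 hy
    omega
  · rw [label_of_mem_Excl hw hg hx', label_of_mem_Excl hw hg hy', Nat.add_left_cancel_iff] at h
    exact Nat.add_right_cancel ((strictAntiOn_card_filter_gt _).injOn hx' hy' h)
  · rw [label_of_mem_setB hg hn hw hx', label_of_mem_setB hg hn hw hy',
      Nat.add_left_cancel_iff] at h
    exact (strictMonoOn_card_filter_lt _).injOn ((mem_setB hw).1 hx').1 ((mem_setB hw).1 hy').1 h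
  · rw [label_of_mem_remainingSpaces hx', label_of_mem_remainingSpaces hy',
      Nat.add_left_cancel_iff] at h
    exact (strictMonoOn_card_filter_lt _).injOn hx' hy' h

lemma space_mem_filter (hg : 1 ≤ g) (hℓ : 1 ≤ ℓ) (hn : g + ℓ ≤ N + 1) (hw : IsWord N w)
    (hc : c < N + 1) :
    space g ℓ (N + 1) w c ∈ ({x ∈ Icc 1 (N + 1) | label g ℓ (N + 1) w x = c} : Finset ℕ) := by
  have hsurj := surjOn_of_injOn_of_card_le _ (mapsTo_label hg hℓ hn hw)
    (injOn_label hg hℓ hn hw) (by rw [card_range, Nat.card_Icc, Nat.add_sub_cancel])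
  obtain ⟨x, hx, hxc⟩ := hsurj (mem_coe.2 (mem_range.2 hc))
  have hmem : x ∈ ({x ∈ Icc 1 (N + 1) | label g ℓ (N + 1) w x = c} : Finset ℕ) :=
    mem_filter.2 ⟨mem_coe.1 hx, hxc⟩
  have hle : space g ℓ (N + 1) w c ≤ x := min_untopD_le (N + 1) hmem
  rcases mem_insert.1 (min_untopD_mem_insert _ (N + 1)) with h | h
  · have hxs : x = space g ℓ (N + 1) w c :=
      ((mem_Icc.1 (mem_coe.1 hx)).2.trans h.ge).antisymm hle
    exact hxs ▸ hmem
  · exact h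

lemma space_mem (hg : 1 ≤ g) (hℓ : 1 ≤ ℓ) (hn : g + ℓ ≤ N + 1) (hw : IsWord N w) (hc : c < N + 1) :
    space g ℓ (N + 1) w c ∈ Icc 1 (N + 1) := (mem_filter.1 (space_mem_filter hg hℓ hn hw hc)).1

lemma label_space (hg : 1 ≤ g) (hℓ : 1 ≤ ℓ) (hn : g + ℓ ≤ N + 1) (hw : IsWord N w)
    (hc : c < N + 1) : label g ℓ (N + 1) w (space g ℓ (N + 1) w c) = c :=
  (mem_filter.1 (space_mem_filter hg hℓ hn hw hc)).2

end Labels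

lemma sum_add_gap_eq {g k : ℕ} {S : Finset ℕ} {p : ℕ → ℕ} (hg : 1 ≤ g)
    (hp : ∀ i ∈ S, p i = if k ≤ i then i + 1 else i) :
    ∑ i ∈ S, (p i + g - 1) = ∑ i ∈ S, (i + g - 1) + #{i ∈ S | k ≤ i} := by
  rw [card_filter, ← sum_add_distrib]
  refine sum_congr rfl fun i hi => ?_
  rw [hp i hi]
  split_ifs <;> omega

namespace IsInsertion

variable {g ℓ N x a e i : ℕ} {w θ : ℕ → ℕ} {T : Finset ℕ}

section Letters

variable (h : IsInsertion g ℓ N w T x a θ)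
include h

lemma place_le_of_mem_Nexcp (hxa : min (x + (g - 1)) (N + 1) ≤ a)
    (hi : i ∈ Nexcp g (g + ℓ) N w) (hai : a < w i) : x ≤ i := by
  rw [mem_Nexcp, mem_Excp] at hi
  have := mem_Icc.1 (h.word.apply_mem hi.1)
  have := mem_Icc.1 h.letter_mem_Icc
  by_contra! hix
  exact hi.2 ⟨hi.1, by omega, by omega⟩

lemma apply_ne_letter_of_mem_Nexcp (hi : i ∈ Nexcp g (g + ℓ) N w) : w i ≠ a := by
  rintro rfl
  rw [mem_Nexcp] at hi
  rcases mem_insert.1 h.letter_mem with hN | hE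
  · have := mem_Icc.1 (h.word.apply_mem hi.1)
    omega
  · exact hi.2 ((h.word.apply_mem_Excl_iff hi.1).1 hE)

lemma letter_lt_raise_iff (hi : i ∈ Excp g (g + ℓ) N w) :
    a < raise g ℓ (N + 1) w a i ↔ a ≤ w i := by
  have hE : w i ∈ Excl g (g + ℓ) N w := apply_mem_Excl hi
  rw [raise_eq_bump]
  rcases lt_or_ge (w i) a with hlt | hle
  · rw [bump_of_lt hlt]
    exact iff_of_false hlt.not_gt hlt.not_ge
  · rw [bump_of_le hE hle]
    exact iff_of_true (hle.trans_lt (lt_nextIn _ (h.letter_lt _ hE))) hle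

end Letters

section Delta

variable (h : IsInsertion g ℓ N w (Icc ℓ N) x a θ) (hx : ℓ ≤ x)
include h hx

lemma bump_Icc (hi : i ∈ Icc 1 N) : bump (Icc ℓ N) (N + 1) x i = if x ≤ i then i + 1 else i := by
  rcases lt_or_ge i ℓ with hil | hil
  · rw [bump_of_lt (hil.trans_le hx), if_neg (hil.trans_le hx).not_ge]
  · exact h.bump_of_level_le hil (mem_Icc.1 hi).2

lemma filter_Nexcp_bump_lt_eq_empty (hxa : min (x + (g - 1)) (N + 1) ≤ a) :
    ({i ∈ Nexcp g (g + ℓ) N w | bump (Icc ℓ N) (N + 1) x i < x ∧ a < w i} : Finset ℕ) = ∅ := by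
  refine filter_eq_empty_iff.2 fun i hi hc => ?_
  have hxi := h.place_le_of_mem_Nexcp hxa hi hc.2
  rw [h.bump_Icc hx (Nexcp_subset hi), if_pos hxi] at hc
  omega

lemma card_filter_Nexcp_lt_bump_add (hxa : min (x + (g - 1)) (N + 1) ≤ a) :
    #{i ∈ Nexcp g (g + ℓ) N w | x < bump (Icc ℓ N) (N + 1) x i ∧ w i < a} +
      #{i ∈ Nexcp g (g + ℓ) N w | a < w i} = #{i ∈ Nexcp g (g + ℓ) N w | x ≤ i} := by
  rw [← card_filter_add_card_filter_not (s := {i ∈ Nexcp g (g + ℓ) N w | x ≤ i}) (w · < a),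
    filter_filter, filter_filter]
  congr 2 <;> refine filter_congr fun i hi => ?_
  · rw [h.bump_Icc hx (Nexcp_subset hi)]
    split_ifs <;> omega
  · have := h.apply_ne_letter_of_mem_Nexcp hi
    have := h.place_le_of_mem_Nexcp hxa hi
    omega

lemma filter_Excp_lt_bump_eq_empty :
    ({i ∈ Excp g (g + ℓ) N w | x < bump (Icc ℓ N) (N + 1) x i ∧
      raise g ℓ (N + 1) w a i < a} : Finset ℕ) = ∅ := by
  refine filter_eq_empty_iff.2 fun i hi hc => ?_
  have hraise := h.le_raise i
  have hletter := h.letter_le i hi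
  rw [h.bump_Icc hx (Excp_subset hi)] at hc
  split_ifs at hc <;> omega

lemma card_filter_Excp_bump_lt_add :
    #{i ∈ Excp g (g + ℓ) N w | bump (Icc ℓ N) (N + 1) x i < x ∧ a < raise g ℓ (N + 1) w a i} +
      #{i ∈ Excp g (g + ℓ) N w | x ≤ i} = #{i ∈ Excp g (g + ℓ) N w | a ≤ w i} := by
  rw [← card_filter_add_card_filter_not (s := {i ∈ Excp g (g + ℓ) N w | a ≤ w i}) (· < x),
    filter_filter, filter_filter]
  congr 2 <;> refine filter_congr fun i hi => ?_
  · rw [h.bump_Icc hx (Excp_subset hi), h.letter_lt_raise_iff hi]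
    split_ifs <;> omega
  · have := h.letter_le i hi
    omega

lemma exc_delta_of_lt (hlt : a < x + g) : exc g ℓ (N + 1) θ = exc g ℓ N w := by
  rw [exc_eq_card, exc_eq_card, h.Excp_eq_of_lt hlt, h.card_filter_image_bump Excp_subset]
  congr 1
  refine filter_congr fun i hi => ?_
  rw [h.bump_Icc hx (Excp_subset hi)]
  split_ifs <;> omega

lemma exc_delta_of_le (hle : x + g ≤ a) : exc g ℓ (N + 1) θ = exc g ℓ N w + 1 := by
  rw [exc_eq_card, exc_eq_card, h.Excp_eq_of_le hle, filter_insert, if_pos hx,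
    card_insert_of_notMem fun hc => h.place_notMem_image Excp_subset (mem_filter.1 hc).1,
    h.card_filter_image_bump Excp_subset]
  congr 2
  refine filter_congr fun i hi => ?_
  rw [h.bump_Icc hx (Excp_subset hi)]
  split_ifs <;> omega

end Delta

section InsertionLetter

lemma insertionLetter_lt_iff (h : IsInsertion g ℓ N w T x (insertionLetter g ℓ (N + 1) w x) θ) :
    insertionLetter g ℓ (N + 1) w x < x + g ↔
      N + 1 - g < x ∨ x + (g - 1) ∈ Excl g (g + ℓ) N w := by
  have hg := h.gap_pos
  have hn := h.le_succ
  have haN := mem_Icc.1 h.letter_mem_Icc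
  have hmin := min_le_insertionLetter (g := g) (ℓ := ℓ) (N := N) (w := w) x
  constructor
  · intro hlt
    rcases mem_insert.1 h.letter_mem with hN | hE
    · left; omega
    · right
      have := h.letter_lt _ hE
      rwa [show x + (g - 1) = insertionLetter g ℓ (N + 1) w x by omega]
  · rintro (hx | hx)
    · omega
    · have := insertionLetter_le hx le_rfl
      omega

variable (h : IsInsertion g ℓ N w (Icc ℓ N) x (insertionLetter g ℓ (N + 1) w x) θ) (hx : ℓ ≤ x)
include h

lemma label_add_sub_insertionLetter (hlt : insertionLetter g ℓ (N + 1) w x < x + g) :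
    label g ℓ (N + 1) w x + (N - insertionLetter g ℓ (N + 1) w x) =
      N + 1 - x + #{e ∈ Excl g (g + ℓ) N w | insertionLetter g ℓ (N + 1) w x < e} := by
  have hg := h.gap_pos
  have hmin := min_le_insertionLetter (g := g) (ℓ := ℓ) (N := N) (w := w) x
  rcases mem_insert.1 h.letter_mem with hN | hE
  · have hn := h.le_succ
    have hlast : N + 1 - g < x := by omega
    rw [label_of_lt hlast, hN, filter_eq_empty_iff.2 fun e he => (h.letter_lt e he).not_gt,
      card_empty]
    omega
  · have := h.letter_lt _ hE
    have hax : x + (g - 1) = insertionLetter g ℓ (N + 1) w x := by omega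
    rw [label_of_mem_Excl h.word hg (hax ▸ hE), hax]
    omega

include hx

lemma den_delta_of_lt (hlt : insertionLetter g ℓ (N + 1) w x < x + g) :
    den g (g + ℓ) (N + 1) θ = den g (g + ℓ) N w + label g ℓ (N + 1) w x := by
  have hxN := mem_Icc.1 h.place_mem_Icc
  have hlabel := h.label_add_sub_insertionLetter hlt
  have hNexcp := h.card_filter_Nexcp_lt_bump_add hx (min_le_insertionLetter x)
  have hplaces := card_filter_Excp_add_card_filter_Nexcp (g := g) (ℓ := g + ℓ) (N := N) (w := w)
    (x ≤ ·)
  have hletters := card_filter_Excp_add_card_filter_Nexcp (g := g) (ℓ := g + ℓ) (N := N) (w := w)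
    (insertionLetter g ℓ (N + 1) w x < w ·)
  have hright : #{i ∈ Icc 1 N | x ≤ i} = N + 1 - x := by
    rw [← Nat.card_Icc x N]
    congr 1
    ext i
    rw [mem_filter, mem_Icc, mem_Icc]
    omega
  rw [hright] at hplaces
  rw [h.word.card_filter_lt_apply,
    h.word.card_filter_Excp (insertionLetter g ℓ (N + 1) w x < ·)] at hletters
  rw [h.den_of_lt hlt, sum_add_gap_eq h.gap_pos fun i hi => h.bump_Icc hx (Excp_subset hi),
    h.filter_Nexcp_bump_lt_eq_empty hx (min_le_insertionLetter x), card_empty, den]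
  omega

lemma den_delta_of_le (hle : x + g ≤ insertionLetter g ℓ (N + 1) w x) :
    den g (g + ℓ) (N + 1) θ = den g (g + ℓ) N w + label g ℓ (N + 1) w x := by
  have hspace := mt h.insertionLetter_lt_iff.2 hle.not_gt
  have hletters : #{e ∈ Excl g (g + ℓ) N w | x + (g - 1) ≤ e} =
      #{e ∈ Excl g (g + ℓ) N w | insertionLetter g ℓ (N + 1) w x ≤ e} :=
    congrArg card (filter_congr fun e he => ⟨insertionLetter_le he, fun h => by omega⟩)
  have hExcp := h.card_filter_Excp_bump_lt_add hx
  rw [h.word.card_filter_Excp (insertionLetter g ℓ (N + 1) w x ≤ ·), ← hletters] at hExcp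
  rw [h.den_of_le hle, sum_add_gap_eq h.gap_pos fun i hi => h.bump_Icc hx (Excp_subset hi),
    h.filter_Excp_lt_bump_eq_empty hx, card_empty, den,
    label_of_level_le h.gap_pos h.level_pos h.le_succ h.word hx (by omega) (not_or.1 hspace).2]
  have := h.gap_pos
  omega

lemma den_delta : den g (g + ℓ) (N + 1) θ = den g (g + ℓ) N w + label g ℓ (N + 1) w x :=
  (lt_or_ge (insertionLetter g ℓ (N + 1) w x) (x + g)).elim (h.den_delta_of_lt hx)
    (h.den_delta_of_le hx)

lemma insertionLetter_lt_iff_label_le : insertionLetter g ℓ (N + 1) w x < x + g ↔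
    label g ℓ (N + 1) w x ≤ exc g ℓ N w + g + ℓ - 2 := by
  have hg := h.gap_pos
  have hℓ := h.level_pos
  have hn := h.le_succ
  have hE := card_Excl_lt (g := g) hℓ (by omega : ℓ ≤ N + 1) h.word
  rw [h.insertionLetter_lt_iff]
  rcases space_cases (g := g) (ℓ := ℓ) (w := w) h.place_mem_Icc with hlast | hxE | hxB | hxR
  · have := label_lt_of_lt (ℓ := ℓ) (w := w) hg hlast
    exact iff_of_true (Or.inl hlast) (by omega)
  · have := mem_Ico.1 (label_mem_Ico_of_mem_Excl hg h.word hxE)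
    exact iff_of_true (Or.inr hxE) (by omega)
  · exact absurd ((mem_setB h.word).1 hxB).2 hx.not_gt
  · have := mem_Ico.1 (label_mem_Ico_of_mem_remainingSpaces hg hℓ hn h.word hxR)
    obtain ⟨hxN, hxE, -⟩ := mem_remainingSpaces.1 hxR
    exact iff_of_false (not_or.2 ⟨(mem_Icc.1 hxN).2.not_gt, hxE⟩) (by omega)

lemma exc_delta : exc g ℓ (N + 1) θ =
    if label g ℓ (N + 1) w x ≤ exc g ℓ N w + g + ℓ - 2 then exc g ℓ N w
    else exc g ℓ N w + 1 := by
  have hlabel := h.insertionLetter_lt_iff_label_le hx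
  split_ifs with hle
  · exact h.exc_delta_of_lt hx (hlabel.2 hle)
  · exact h.exc_delta_of_le hx (not_lt.1 (mt hlabel.1 hle))

end InsertionLetter

section FirstLetter

variable (h : IsInsertion g ℓ N w T x (firstLetter g ℓ (N + 1) w) θ)
include h

lemma add_gap_le_firstLetter (hx : x < ℓ) : x + g ≤ firstLetter g ℓ (N + 1) w := by
  have := mem_Icc.1 h.letter_mem_Icc
  omega

lemma firstLetter_mem_Excl (hx : x < ℓ) :
    firstLetter g ℓ (N + 1) w ∈ Excl g (g + ℓ) (N + 1) θ :=
  h.Excl_eq_of_le (h.add_gap_le_firstLetter hx) ▸ h.letter_mem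

lemma firstLetter_le_of_mem_Excl (hx : x < ℓ) (he : e ∈ Excl g (g + ℓ) (N + 1) θ) :
    firstLetter g ℓ (N + 1) w ≤ e := by
  rw [h.Excl_eq_of_le (h.add_gap_le_firstLetter hx)] at he
  rcases mem_insert.1 he with rfl | he
  · exact (mem_Icc.1 h.letter_mem_Icc).2
  · exact firstLetter_le he

lemma den_firstLetter (hx : x < ℓ) : den g (g + ℓ) (N + 1) θ =
    (∑ i ∈ Excp g (g + ℓ) N w, (bump T (N + 1) x i + g - 1)) + (x + g - 1) +
      invOn w (Excp g (g + ℓ) N w) + invOn w (Nexcp g (g + ℓ) N w) +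
      #{i ∈ Excp g (g + ℓ) N w | i < x} := by
  have hraise : ∀ i ∈ Excp g (g + ℓ) N w,
      firstLetter g ℓ (N + 1) w < raise g ℓ (N + 1) w (firstLetter g ℓ (N + 1) w) i :=
    fun i hi => (h.letter_lt_raise_iff hi).2 (firstLetter_le (apply_mem_Excl hi))
  have hleft : ({i ∈ Excp g (g + ℓ) N w | bump T (N + 1) x i < x ∧ firstLetter g ℓ (N + 1) w <
      raise g ℓ (N + 1) w (firstLetter g ℓ (N + 1) w) i} : Finset ℕ) =
      {i ∈ Excp g (g + ℓ) N w | i < x} := filter_congr fun i hi =>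
    ⟨fun hc => (le_bump h.place_lt).trans_lt hc.1,
      fun hix => ⟨(bump_of_lt hix).trans_lt hix, hraise i hi⟩⟩
  have hright : ({i ∈ Excp g (g + ℓ) N w | x < bump T (N + 1) x i ∧
      raise g ℓ (N + 1) w (firstLetter g ℓ (N + 1) w) i < firstLetter g ℓ (N + 1) w} :
      Finset ℕ) = ∅ := filter_eq_empty_iff.2 fun i hi hc => (hraise i hi).not_gt hc.2
  rw [h.den_of_le (h.add_gap_le_firstLetter hx), hleft, hright, card_empty, add_zero]

lemma exc_firstLetter (hx : x < ℓ) :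
    exc g ℓ (N + 1) θ = #{i ∈ Excp g (g + ℓ) N w | ℓ ≤ bump T (N + 1) x i} := by
  rw [exc_eq_card, h.Excp_eq_of_le (h.add_gap_le_firstLetter hx), filter_insert,
    if_neg hx.not_ge, h.card_filter_image_bump Excp_subset]

end FirstLetter

section Alpha

lemma sum_bump_setA (h : IsInsertion g ℓ N w (setA g ℓ (N + 1) w ∪ Icc ℓ N) x a θ)
    (hx : x ∈ setA g ℓ (N + 1) w) (f : ℕ → ℕ) :
    ∑ i ∈ Excp g (g + ℓ) N w, f (bump (setA g ℓ (N + 1) w ∪ Icc ℓ N) (N + 1) x i) + f x =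
      ∑ i ∈ Excp g (g + ℓ) N w, f (if ℓ ≤ i then i + 1 else i) + f ℓ := by
  have hsub := setA_subset (g := g) (ℓ := ℓ) h.word
  have hlt : ∀ i ∈ setA g ℓ (N + 1) w, i < ℓ := fun i hi => (mem_Ico.1 (hsub hi)).2
  have hins : x ∈ insert ℓ (setA g ℓ (N + 1) w) := mem_insert_of_mem hx
  have hN : ℓ ≤ N := by
    have := h.le_succ
    have := h.gap_pos
    omega
  have hleft : ∑ i ∈ setA g ℓ (N + 1) w,
      f (bump (setA g ℓ (N + 1) w ∪ Icc ℓ N) (N + 1) x i) + f x =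
        ∑ i ∈ setA g ℓ (N + 1) w, f (if ℓ ≤ i then i + 1 else i) + f ℓ :=
    calc _ = ∑ i ∈ setA g ℓ (N + 1) w, f (bump (setA g ℓ (N + 1) w) ℓ x i) + f x := by
          rw [sum_congr rfl fun i hi => by rw [bump_union_Icc_of_lt hsub hN (hlt i hi)]]
      _ = ∑ i ∈ insert ℓ (setA g ℓ (N + 1) w), f i := by
          rw [← sum_image (f := f) (injOn_bump Subset.rfl hlt hins), image_bump hlt hins,
            sum_erase_add _ _ hins]
      _ = _ := by
          rw [sum_insert fun hc => lt_irrefl _ (hlt ℓ hc), add_comm]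
          congr 1
          exact sum_congr rfl fun i hi => by rw [if_neg (hlt i hi).not_ge]
  rw [← sum_filter_add_sum_filter_not _ (· < ℓ), ← sum_filter_add_sum_filter_not _ (· < ℓ)
    (fun i => f (if ℓ ≤ i then i + 1 else i)), ← setA_eq_filter h.word, add_right_comm, hleft,
    add_right_comm]
  congr 2
  refine sum_congr rfl fun i hi => ?_
  obtain ⟨hi, hil⟩ := mem_filter.1 hi
  have hxi := (hlt x hx).le.trans (not_lt.1 hil)
  rw [h.bump_of_level_le (not_lt.1 hil) (mem_Icc.1 (Excp_subset hi)).2, if_pos hxi,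
    if_pos (not_lt.1 hil)]

variable (h : IsInsertion g ℓ N w (setA g ℓ (N + 1) w ∪ Icc ℓ N) x
  (firstLetter g ℓ (N + 1) w) θ) (hx : x ∈ setA g ℓ (N + 1) w)
include h hx

lemma den_alpha :
    den g (g + ℓ) (N + 1) θ = den g (g + ℓ) N w + label g ℓ (N + 1) w x := by
  have hg := h.gap_pos
  have hsum := h.sum_bump_setA hx (· + g - 1)
  have hind := sum_add_gap_eq (S := Excp g (g + ℓ) N w) (k := ℓ) hg fun i _ => rfl
  rw [← exc_eq_card] at hind
  rw [h.den_firstLetter ((mem_setA h.word).1 hx).2, label_of_mem_setA hg h.le_succ h.word hx, den]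
  omega

lemma exc_alpha : exc g ℓ (N + 1) θ =
    if label g ℓ (N + 1) w x ≤ exc g ℓ N w + g + ℓ - 2 then exc g ℓ N w
    else exc g ℓ N w + 1 := by
  have hg := h.gap_pos
  have hxl := ((mem_setA h.word).1 hx).2
  have hsum := h.sum_bump_setA hx (fun i => if ℓ ≤ i then 1 else 0)
  rw [if_neg hxl.not_ge, if_pos le_rfl, add_zero] at hsum
  rw [if_neg, h.exc_firstLetter hxl, exc_eq_card, card_filter, card_filter, hsum]
  · congr 1
    exact sum_congr rfl fun i _ => by split_ifs <;> omega
  · rw [label_of_mem_setA hg h.le_succ h.word hx]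
    omega

end Alpha

section BetaStar

lemma bump_setB (h : IsInsertion g ℓ N w (setB g ℓ (N + 1) w ∪ Icc ℓ N) x a θ)
    (hx : x ∈ setB g ℓ (N + 1) w) (hi : i ∈ Excp g (g + ℓ) N w) :
    bump (setB g ℓ (N + 1) w ∪ Icc ℓ N) (N + 1) x i = if ℓ ≤ i then i + 1 else i := by
  have hxl := ((mem_setB h.word).1 hx).2
  split_ifs with hil
  · rw [h.bump_of_level_le hil (mem_Icc.1 (Excp_subset hi)).2, if_pos (hxl.le.trans hil)]
  · refine bump_of_notMem fun hc => ?_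
    rw [mem_union, mem_setB h.word, mem_Nexcp] at hc
    exact hc.elim (fun hB => hB.1.2 hi) fun hI => hil (mem_Icc.1 hI).1

variable (h : IsInsertion g ℓ N w (setB g ℓ (N + 1) w ∪ Icc ℓ N) x
  (firstLetter g ℓ (N + 1) w) θ) (hx : x ∈ setB g ℓ (N + 1) w)
include h hx

lemma den_setB : den g (g + ℓ) (N + 1) θ =
    den g (g + ℓ) N w + (x + g - 1) + exc g ℓ N w + #{i ∈ Excp g (g + ℓ) N w | i < x} := by
  rw [h.den_firstLetter ((mem_setB h.word).1 hx).2,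
    sum_add_gap_eq h.gap_pos fun i hi => h.bump_setB hx hi, ← exc_eq_card, den]
  ring

lemma exc_setB : exc g ℓ (N + 1) θ = exc g ℓ N w := by
  rw [h.exc_firstLetter ((mem_setB h.word).1 hx).2, exc_eq_card]
  congr 1
  refine filter_congr fun i hi => ?_
  rw [h.bump_setB hx hi]
  split_ifs <;> omega

end BetaStar

end IsInsertion

section CyclicPred

variable {α : Type*} [LinearOrder α] {E : Finset α} {m y z : α}

/-- The element that precedes `z` in the cyclic order of `E`, the smallest element being preceded
by the largest one; an element outside `E` is fixed. -/
def cyclicPred (E : Finset α) (z : α) : α :=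
  if z ∈ E then ({e ∈ E | e < z}).max.unbotD (E.max.unbotD z) else z

lemma cyclicPred_of_notMem (hz : z ∉ E) : cyclicPred E z = z := if_neg hz

lemma cyclicPred_mem (hz : z ∈ E) : cyclicPred E z ∈ E := by
  rw [cyclicPred, if_pos hz]
  rcases ({e ∈ E | e < z}).eq_empty_or_nonempty with hE | hE
  · rw [hE, max_empty, WithBot.unbotD_bot]
    exact max_unbotD_mem ⟨z, hz⟩ z
  · exact (mem_filter.1 (max_unbotD_mem hE _)).1

lemma cyclicPred_mem_iff : cyclicPred E z ∈ E ↔ z ∈ E :=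
  ⟨fun h => by_contra fun hz => hz (cyclicPred_of_notMem hz ▸ h), cyclicPred_mem⟩

lemma cyclicPred_lt (hz : z ∈ E) (hm : m ∈ E) (hmz : m < z) : cyclicPred E z < z := by
  have hne : ({e ∈ E | e < z}).Nonempty := ⟨m, mem_filter.2 ⟨hm, hmz⟩⟩
  rw [cyclicPred, if_pos hz]
  exact (mem_filter.1 (max_unbotD_mem hne _)).2

lemma le_cyclicPred (hz : z ∈ E) (hm : m ∈ E) (hmz : m < z) : m ≤ cyclicPred E z := by
  rw [cyclicPred, if_pos hz]
  exact le_max_unbotD _ (mem_filter.2 ⟨hm, hmz⟩)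

lemma le_cyclicPred_of_forall_le (hz : z ∈ E) (hmin : ∀ e ∈ E, z ≤ e) (hm : m ∈ E) :
    m ≤ cyclicPred E z := by
  rw [cyclicPred, if_pos hz, filter_eq_empty_iff.2 fun e he => (hmin e he).not_gt, max_empty,
    WithBot.unbotD_bot]
  exact le_max_unbotD _ hm

lemma cyclicPred_lt_cyclicPred (hm : m ∈ E) (hmz : m < z) (hz : z ∈ E) (hy : y ∈ E)
    (hzy : z < y) : cyclicPred E z < cyclicPred E y :=
  (cyclicPred_lt hz hm hmz).trans_le (le_cyclicPred hy hz hzy)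

lemma cyclicPred_injective (E : Finset α) : Function.Injective (cyclicPred E) := by
  have hne {z y : α} (hz : z ∈ E) (hy : y ∈ E) (hzy : z < y) :
      cyclicPred E z ≠ cyclicPred E y := by
    by_cases hmin : ∀ e ∈ E, z ≤ e
    · exact ((cyclicPred_lt hy hz hzy).trans_le (le_cyclicPred_of_forall_le hz hmin hy)).ne'
    · push Not at hmin
      obtain ⟨m, hm, hmz⟩ := hmin
      exact (cyclicPred_lt_cyclicPred hm hmz hz hy hzy).ne
  intro z y h
  have hiff : z ∈ E ↔ y ∈ E := by rw [← cyclicPred_mem_iff, h, cyclicPred_mem_iff]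
  by_cases hz : z ∈ E
  · rcases lt_trichotomy z y with hzy | hzy | hzy
    · exact absurd h (hne hz (hiff.1 hz) hzy)
    · exact hzy
    · exact absurd h.symm (hne (hiff.1 hz) hz hzy)
  · rwa [cyclicPred_of_notMem hz, cyclicPred_of_notMem (mt hiff.2 hz)] at h

lemma image_cyclicPred (E : Finset α) : E.image (cyclicPred E) = E :=
  eq_of_subset_of_card_le (image_subset_iff.2 fun _ => cyclicPred_mem)
    (card_image_of_injective _ (cyclicPred_injective E)).ge

end CyclicPred

section Rotation

variable {g k ℓ N i : ℕ} {v v' : ℕ → ℕ}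

/-- The `g`-gap `(g+ℓ)`-level excedance letters at places to the left of `ℓ`, which `rotate`
permutes. -/
def lowLetters (g ℓ N : ℕ) (v : ℕ → ℕ) : Finset ℕ :=
  ({i ∈ Excp g (g + ℓ) N v | i < ℓ}).image v

lemma rotate_apply (v : ℕ → ℕ) (i : ℕ) :
    rotate g ℓ N v i = cyclicPred (lowLetters g ℓ N v) (v i) := by
  rw [rotate, cyclicPred, lowLetters]
  split_ifs with hi
  · obtain ⟨m, hm⟩ := max_of_mem hi
    rw [hm]
    rfl
  · rfl

lemma lowLetters_subset (v : ℕ → ℕ) : lowLetters g ℓ N v ⊆ Excl g (g + ℓ) N v :=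
  image_subset_image (filter_subset _ _)

lemma IsWord.apply_mem_lowLetters (hv : IsWord N v) :
    v i ∈ lowLetters g ℓ N v ↔ i ∈ Excp g (g + ℓ) N v ∧ i < ℓ := by
  refine ⟨fun hi => ?_, fun hi => mem_image_of_mem v (mem_filter.2 hi)⟩
  obtain ⟨j, hj, hji⟩ := mem_image.1 hi
  have hjN := Excp_subset (mem_filter.1 hj).1
  have hiN : i ∈ Icc 1 N := by
    by_contra hiN
    have := mem_Icc.1 (hv.apply_mem hjN)
    rw [hji, hv.eq_zero i hiN] at this
    omega
  exact hv.injOn hjN hiN hji ▸ mem_filter.1 hj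

lemma rotate_apply_of_notMem (hv : IsWord N v) (hi : ¬(i ∈ Excp g (g + ℓ) N v ∧ i < ℓ)) :
    rotate g ℓ N v i = v i := by
  rw [rotate_apply, cyclicPred_of_notMem (mt hv.apply_mem_lowLetters.1 hi)]

lemma rotate_apply_mem (hv : IsWord N v) (hi : i ∈ Excp g (g + ℓ) N v) (hiℓ : i < ℓ) :
    rotate g ℓ N v i ∈ Excl g (g + ℓ) N v := by
  rw [rotate_apply]
  exact lowLetters_subset v (cyclicPred_mem (hv.apply_mem_lowLetters.2 ⟨hi, hiℓ⟩))

lemma isWord_rotate (hv : IsWord N v) : IsWord N (rotate g ℓ N v) where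
  image_eq := by
    refine eq_of_subset_of_card_le (image_subset_iff.2 fun i hi => ?_) ?_
    · by_cases h : i ∈ Excp g (g + ℓ) N v ∧ i < ℓ
      · have := mem_Icc.1 (hv.Excl_subset (rotate_apply_mem hv h.1 h.2))
        have := mem_Icc.1 hi
        exact mem_Icc.2 (by omega)
      · rw [rotate_apply_of_notMem hv h]
        exact hv.apply_mem hi
    · refine (card_image_of_injOn fun i hi j hj hij => hv.injOn hi hj ?_).ge
      rw [rotate_apply, rotate_apply] at hij
      exact cyclicPred_injective _ hij
  eq_zero i hi := by
    rw [rotate_apply_of_notMem hv fun h => hi (Excp_subset h.1), hv.eq_zero i hi]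

lemma Excp_rotate (hv : IsWord N v) (hk : k ≤ g) :
    Excp k (g + ℓ) N (rotate g ℓ N v) = Excp k (g + ℓ) N v := by
  ext i
  by_cases h : i ∈ Excp g (g + ℓ) N v ∧ i < ℓ
  · have := mem_Icc.1 (hv.Excl_subset (rotate_apply_mem hv h.1 h.2))
    exact iff_of_true (mem_Excp.2 ⟨Excp_subset h.1, by omega, this.1⟩)
      (Excp_subset_of_gap_le hk h.1)
  · rw [mem_Excp, mem_Excp, rotate_apply_of_notMem hv h]

lemma Nexcp_rotate (hv : IsWord N v) :
    Nexcp g (g + ℓ) N (rotate g ℓ N v) = Nexcp g (g + ℓ) N v := by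
  rw [Nexcp, Nexcp, Excp_rotate hv le_rfl]

lemma lowLetters_rotate (hv : IsWord N v) :
    lowLetters g ℓ N (rotate g ℓ N v) = lowLetters g ℓ N v := by
  conv_rhs => rw [← image_cyclicPred (lowLetters g ℓ N v)]
  rw [lowLetters, lowLetters, Excp_rotate hv le_rfl, image_image]
  exact image_congr fun i _ => rotate_apply v i

lemma Excl_rotate (hv : IsWord N v) (hk : k ≤ g) :
    Excl k (g + ℓ) N (rotate g ℓ N v) = Excl k (g + ℓ) N v := by
  refine eq_of_subset_of_card_le (fun e he => ?_) ?_
  · obtain ⟨i, hi, rfl⟩ := mem_Excl.1 he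
    rw [Excp_rotate hv hk] at hi
    by_cases h : i ∈ Excp g (g + ℓ) N v ∧ i < ℓ
    · exact Excl_subset_of_gap_le hk (rotate_apply_mem hv h.1 h.2)
    · rw [rotate_apply_of_notMem hv h]
      exact apply_mem_Excl hi
  · rw [← hv.card_Excp, ← (isWord_rotate hv).card_Excp, Excp_rotate hv hk]

lemma rotate_injOn : Set.InjOn (rotate g ℓ N) {v | IsWord N v} := by
  intro v hv v' hv' h
  have hE : lowLetters g ℓ N v = lowLetters g ℓ N v' := by
    rw [← lowLetters_rotate hv, h, lowLetters_rotate hv']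
  funext i
  have hi := congrFun h i
  rw [rotate_apply, rotate_apply, hE] at hi
  exact cyclicPred_injective _ hi

lemma exc_rotate (hv : IsWord N v) : exc g ℓ N (rotate g ℓ N v) = exc g ℓ N v := by
  rw [exc_eq_card, exc_eq_card, Excp_rotate hv le_rfl]

lemma den_rotate_add (hv : IsWord N v) :
    den g (g + ℓ) N (rotate g ℓ N v) + invOn v {i ∈ Excp g (g + ℓ) N v | i < ℓ} =
      den g (g + ℓ) N v + invOn (rotate g ℓ N v) {i ∈ Excp g (g + ℓ) N v | i < ℓ} := by
  have hNexcp : invOn (rotate g ℓ N v) (Nexcp g (g + ℓ) N v) = invOn v (Nexcp g (g + ℓ) N v) :=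
    invOn_congr fun i hi => rotate_apply_of_notMem hv fun h => (mem_Nexcp.1 hi).2 h.1
  have himage : ({i ∈ Excp g (g + ℓ) N v | i < ℓ}).image (rotate g ℓ N v) =
      ({i ∈ Excp g (g + ℓ) N v | i < ℓ}).image v := by
    have h := lowLetters_rotate (g := g) (ℓ := ℓ) hv
    rwa [lowLetters, lowLetters, Excp_rotate hv le_rfl] at h
  have hExcp := invOn_union_add (v := v) (θ := rotate g ℓ N v)
    (S := {i ∈ Excp g (g + ℓ) N v | i < ℓ}) (U := {i ∈ Excp g (g + ℓ) N v | ¬i < ℓ})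
    (fun i hi j hj => (mem_filter.1 hi).2.trans_le (not_lt.1 (mem_filter.1 hj).2))
    (fun j hj => rotate_apply_of_notMem hv fun h => (mem_filter.1 hj).2 h.2) himage
    (hv.injOn.mono fun i hi => Excp_subset (mem_filter.1 hi).1)
  rw [filter_union_filter_not_eq] at hExcp
  rw [den, den, Excp_rotate hv le_rfl, Nexcp_rotate hv, hNexcp]
  omega

end Rotation

namespace IsInsertion

section BetaStar

variable {g ℓ N x i j : ℕ} {w v : ℕ → ℕ}
variable (h : IsInsertion g ℓ N w (setB g ℓ (N + 1) w ∪ Icc ℓ N) x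
  (firstLetter g ℓ (N + 1) w) v) (hx : x ∈ setB g ℓ (N + 1) w)
include h hx

lemma filter_Excp_lt_level_of_mem_setB :
    {i ∈ Excp g (g + ℓ) (N + 1) v | i < ℓ} = insert x (setA g ℓ (N + 1) w) := by
  have hxℓ := ((mem_setB h.word).1 hx).2
  rw [h.Excp_eq_of_le (h.add_gap_le_firstLetter hxℓ), filter_insert, if_pos hxℓ]
  congr 1
  ext p
  rw [mem_filter, mem_image, mem_setA h.word]
  constructor
  · rintro ⟨⟨i, hi, rfl⟩, hp⟩
    rw [h.bump_setB hx hi] at hp ⊢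
    split_ifs at hp ⊢ with hil
    · omega
    · exact ⟨hi, hp⟩
  · rintro ⟨hp, hpℓ⟩
    exact ⟨⟨p, hp, by rw [h.bump_setB hx hp, if_neg hpℓ.not_ge]⟩, hpℓ⟩

lemma place_notMem_setA : x ∉ setA g ℓ (N + 1) w := fun hA =>
  (mem_Nexcp.1 ((mem_setB h.word).1 hx).1).2 ((mem_setA h.word).1 hA).1

lemma apply_mem_lowLetters (hi : i ∈ insert x (setA g ℓ (N + 1) w)) :
    v i ∈ lowLetters g ℓ (N + 1) v := by
  rw [← h.filter_Excp_lt_level_of_mem_setB hx] at hi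
  exact h.isWord.apply_mem_lowLetters.2 (mem_filter.1 hi)

lemma apply_place_lt (hi : i ∈ setA g ℓ (N + 1) w) : v x < v i := by
  obtain ⟨hi, hiℓ⟩ := (mem_setA h.word).1 hi
  have hvi := h.apply_bump i (Excp_subset hi)
  rw [h.bump_setB hx hi, if_neg hiℓ.not_ge] at hvi
  rw [hvi, h.apply_place, h.letter_lt_raise_iff hi]
  exact firstLetter_le (apply_mem_Excl hi)

lemma rotate_apply_lt_rotate_place (hi : i ∈ setA g ℓ (N + 1) w) :
    rotate g ℓ (N + 1) v i < rotate g ℓ (N + 1) v x := by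
  have hmin : ∀ e ∈ lowLetters g ℓ (N + 1) v, v x ≤ e := fun e he => by
    rw [h.apply_place]
    exact h.firstLetter_le_of_mem_Excl ((mem_setB h.word).1 hx).2 (lowLetters_subset v he)
  have hi' := h.apply_mem_lowLetters hx (mem_insert_of_mem hi)
  rw [rotate_apply, rotate_apply]
  refine lt_of_le_of_ne (le_cyclicPred_of_forall_le
    (h.apply_mem_lowLetters hx (mem_insert_self _ _)) hmin (cyclicPred_mem hi')) fun heq => ?_
  exact (h.apply_place_lt hx hi).ne' (cyclicPred_injective _ heq)

lemma invOn_rotate_setA :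
    invOn (rotate g ℓ (N + 1) v) (setA g ℓ (N + 1) w) = invOn v (setA g ℓ (N + 1) w) := by
  have hmono : ∀ i ∈ setA g ℓ (N + 1) w, ∀ j ∈ setA g ℓ (N + 1) w, v i < v j →
      rotate g ℓ (N + 1) v i < rotate g ℓ (N + 1) v j := fun i hi j hj hij => by
    rw [rotate_apply, rotate_apply]
    exact cyclicPred_lt_cyclicPred (h.apply_mem_lowLetters hx (mem_insert_self _ _))
      (h.apply_place_lt hx hi) (h.apply_mem_lowLetters hx (mem_insert_of_mem hi))
      (h.apply_mem_lowLetters hx (mem_insert_of_mem hj)) hij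
  refine congrArg card (filter_congr fun p hp => and_congr_right fun _ => ?_)
  obtain ⟨hp₁, hp₂⟩ := mem_product.1 hp
  refine ⟨fun hlt => ?_, hmono _ hp₂ _ hp₁⟩
  by_contra hge
  rcases (not_lt.1 hge).eq_or_lt with heq | hgt
  · rw [rotate_apply, rotate_apply, heq] at hlt
    exact lt_irrefl _ hlt
  · exact lt_asymm hlt (hmono _ hp₁ _ hp₂ hgt)

lemma invOn_insert_place : invOn v (insert x (setA g ℓ (N + 1) w)) =
    invOn v (setA g ℓ (N + 1) w) + #{i ∈ setA g ℓ (N + 1) w | i < x} := by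
  rw [invOn_insert (h.place_notMem_setA hx), filter_congr (q := (· < x)) fun i hi =>
      and_iff_left (h.apply_place_lt hx hi), filter_eq_empty_iff (p := fun i => x < i ∧ v i < v x)
    |>.2 fun i hi hc => lt_asymm hc.2 (h.apply_place_lt hx hi), card_empty, add_zero]

lemma invOn_rotate_insert_place :
    invOn (rotate g ℓ (N + 1) v) (insert x (setA g ℓ (N + 1) w)) =
      invOn v (setA g ℓ (N + 1) w) + #{i ∈ setA g ℓ (N + 1) w | ¬i < x} := by
  have hright : {i ∈ setA g ℓ (N + 1) w |
      x < i ∧ rotate g ℓ (N + 1) v i < rotate g ℓ (N + 1) v x} =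
      {i ∈ setA g ℓ (N + 1) w | ¬i < x} := filter_congr fun i hi => by
    rw [and_iff_left (h.rotate_apply_lt_rotate_place hx hi), not_lt]
    have hne : i ≠ x := fun hc => h.place_notMem_setA hx (hc ▸ hi)
    exact ⟨le_of_lt, fun hle => hle.lt_of_ne' hne⟩
  rw [invOn_insert (h.place_notMem_setA hx), h.invOn_rotate_setA hx, hright,
    filter_eq_empty_iff.2 fun i hi hc => lt_asymm hc.2 (h.rotate_apply_lt_rotate_place hx hi),
    card_empty, add_zero]

lemma den_betaStar : den g (g + ℓ) (N + 1) (rotate g ℓ (N + 1) v) =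
    den g (g + ℓ) N w + label g ℓ (N + 1) w x := by
  have hg := h.gap_pos
  have hn := h.le_succ
  obtain ⟨hxN, hxℓ⟩ := (mem_setB h.word).1 hx
  have hrotate := den_rotate_add (g := g) (ℓ := ℓ) h.isWord
  rw [h.filter_Excp_lt_level_of_mem_setB hx, h.invOn_insert_place hx,
    h.invOn_rotate_insert_place hx, h.den_setB hx] at hrotate
  have hplaces := card_filter_lt_Excp_add_card_filter_lt_Nexcp (g := g) (ℓ := g + ℓ) (w := w)
    (by omega : x ≤ N + 1)
  have hA : #{i ∈ setA g ℓ (N + 1) w | i < x} = #{i ∈ Excp g (g + ℓ) N w | i < x} := by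
    rw [setA_eq_filter h.word, filter_filter]
    exact congrArg card (filter_congr fun i _ => and_iff_right_of_imp fun hi => hi.trans hxℓ)
  have hsplit := card_filter_add_card_filter_not (s := setA g ℓ (N + 1) w) (· < x)
  have hcard := card_setA_add_exc (g := g) (ℓ := ℓ) h.word
  have hpos := (mem_Icc.1 (Nexcp_subset hxN)).1
  rw [label_of_mem_setB hg hn h.word hx]
  omega

lemma exc_betaStar : exc g ℓ (N + 1) (rotate g ℓ (N + 1) v) =
    if label g ℓ (N + 1) w x ≤ exc g ℓ N w + g + ℓ - 2 then exc g ℓ N w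
    else exc g ℓ N w + 1 := by
  have hlabel := mem_Ico.1 (label_mem_Ico_of_mem_setB h.gap_pos h.le_succ h.word hx)
  rw [exc_rotate h.isWord, h.exc_setB hx, if_pos (by omega)]

end BetaStar

end IsInsertion

section Anchor

variable {g ℓ N p : ℕ} {v : ℕ → ℕ}

/-- An anchor of a word `θ` of length `N` is a place `p ≥ ℓ` whose letter is an excedance letter
for the gap `g - 1`, all smaller letters of this kind being less than `p + (g - 1)`. The letter
inserted by `δ` stands at the anchor with the largest letter if `N` is an excedance letter for the
gap `g`, whereas the images under `α` and `β*` have no anchors. -/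
def IsAnchor (g ℓ N : ℕ) (θ : ℕ → ℕ) (p : ℕ) : Prop :=
  ℓ ≤ p ∧ p ∈ Excp (g - 1) (g + ℓ) N θ ∧
    ∀ f ∈ Excl (g - 1) (g + ℓ) N θ, f < θ p → f < p + (g - 1)

lemma isAnchor_rotate (hv : IsWord N v) :
    IsAnchor g ℓ N (rotate g ℓ N v) p ↔ IsAnchor g ℓ N v p := by
  refine and_congr_right fun hp => ?_
  rw [Excp_rotate hv (Nat.sub_le g 1), Excl_rotate hv (Nat.sub_le g 1),
    rotate_apply_of_notMem hv fun h => h.2.not_ge hp]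

end Anchor

namespace IsInsertion

variable {g ℓ N x x' a i p : ℕ} {w w' θ : ℕ → ℕ} {T T' S : Finset ℕ}

section Anchor

variable (h : IsInsertion g ℓ N w T x a θ)
include h

lemma bump_le_max (hi : i ∈ Icc 1 N) : bump T (N + 1) x i ≤ max (i + 1) ℓ := by
  rcases lt_or_ge i ℓ with hil | hil
  · exact le_max_of_le_right (h.bump_le_level hil)
  · rw [h.bump_of_level_le hil (mem_Icc.1 hi).2]
    split_ifs <;> omega

lemma bump_eq_self_of_mem_Excp_pred_gap (hi : i ∈ Nexcp g (g + ℓ) N w)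
    (hp : bump T (N + 1) x i ∈ Excp (g - 1) (g + ℓ) (N + 1) θ) :
    bump T (N + 1) x i = i ∧ w i < i + g := by
  have hle : i ≤ bump T (N + 1) x i := le_bump h.place_lt
  have := h.gap_pos
  rw [mem_Excp, h.apply_bump_of_mem_Nexcp hi] at hp
  rw [mem_Nexcp, mem_Excp] at hi
  grind

lemma lt_place_of_bump_eq_self (hi : i ∈ Icc 1 N) (hil : ℓ ≤ i)
    (hbump : bump T (N + 1) x i = i) : i < x := by
  rw [h.bump_of_level_le hil (mem_Icc.1 hi).2] at hbump
  split_ifs at hbump <;> omega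

lemma Excl_subset_Excl_pred_gap (hxa : x + (g - 1) ≤ a) :
    Excl g (g + ℓ) N w ⊆ Excl (g - 1) (g + ℓ) (N + 1) θ := by
  have hx : x ∈ Excp (g - 1) (g + ℓ) (N + 1) θ := mem_Excp.2 ⟨h.place_mem_Icc, by
    rwa [h.apply_place, and_iff_left (mem_Icc.1 h.letter_mem_Icc).1]⟩
  rw [h.Excl_eq]
  exact (erase_subset _ _).trans (insert_subset (h.apply_place ▸ apply_mem_Excl hx)
    (Excl_subset_of_gap_le (Nat.sub_le g 1)))

lemma apply_lt_letter_of_isAnchor (hxa : x + (g - 1) ≤ a) (hi : i ∈ Excp g (g + ℓ) N w)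
    (hp : IsAnchor g ℓ (N + 1) θ (bump T (N + 1) x i)) : w i < a := by
  by_contra hai
  have := h.gap_pos
  have hE := apply_mem_Excl hi
  have hwi : w i < θ (bump T (N + 1) x i) := by
    rw [h.apply_bump i (Excp_subset hi), raise_eq_bump, bump_of_le hE (not_lt.1 hai)]
    exact lt_nextIn _ (h.letter_lt _ hE)
  have hlt := hp.2.2 (w i) (h.Excl_subset_Excl_pred_gap hxa hE) hwi
  have hle := h.bump_le_max (Excp_subset hi)
  have hexc := mem_Excp.1 hi
  omega

lemma apply_le_letter_of_isAnchor (hxa : x + (g - 1) ≤ a) (hp : IsAnchor g ℓ (N + 1) θ p) :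
    θ p ≤ a := by
  by_cases hpx : p = x
  · rw [hpx, h.apply_place]
  obtain ⟨i, hi, rfl⟩ := h.exists_bump_place_eq (Excp_subset hp.2.1) hpx
  by_cases hiE : i ∈ Excp g (g + ℓ) N w
  · have hia := h.apply_lt_letter_of_isAnchor hxa hiE hp
    rw [h.apply_bump i hi, raise_eq_bump, bump_of_lt hia]
    exact hia.le
  · have hiN := mem_Nexcp.2 ⟨hi, hiE⟩
    obtain ⟨hbump, hwi⟩ := h.bump_eq_self_of_mem_Excp_pred_gap hiN hp.2.1
    have := h.lt_place_of_bump_eq_self hi (hbump ▸ hp.1) hbump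
    rw [h.apply_bump_of_mem_Nexcp hiN]
    omega

lemma isAnchor_place (hx : ℓ ≤ x) (hxa : x + (g - 1) ≤ a)
    (hmin : ∀ e ∈ Excl g (g + ℓ) N w, x + (g - 1) ≤ e → a ≤ e) : IsAnchor g ℓ (N + 1) θ x := by
  rw [IsAnchor, mem_Excp, h.apply_place]
  refine ⟨hx, ⟨h.place_mem_Icc, hxa, (mem_Icc.1 h.letter_mem_Icc).1⟩, fun f hf hfa => ?_⟩
  obtain ⟨p, hp, rfl⟩ := mem_Excl.1 hf
  have hpx : p ≠ x := by
    rintro rfl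
    exact hfa.ne h.apply_place
  obtain ⟨i, hi, rfl⟩ := h.exists_bump_place_eq (Excp_subset hp) hpx
  by_cases hiE : i ∈ Excp g (g + ℓ) N w
  · rw [h.apply_bump i hi] at hfa ⊢
    have hia := (h.le_raise i).trans_lt hfa
    rw [raise_eq_bump, bump_of_lt hia]
    exact not_le.1 (mt (hmin _ (apply_mem_Excl hiE)) hia.not_ge)
  · have hiN := mem_Nexcp.2 ⟨hi, hiE⟩
    obtain ⟨hbump, hwi⟩ := h.bump_eq_self_of_mem_Excp_pred_gap hiN hp
    have := h.lt_place_of_bump_eq_self hi (i := i)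
    rw [h.apply_bump_of_mem_Nexcp hiN]
    grind

end Anchor

section Delta

variable (h : IsInsertion g ℓ N w T x (insertionLetter g ℓ (N + 1) w x) θ)
include h

lemma insertionLetter_eq_of_notMem_Excl (hN : N + 1 ∉ Excl g (g + ℓ) (N + 1) θ) :
    insertionLetter g ℓ (N + 1) w x = N + 1 := by
  by_contra hne
  rcases lt_or_ge (insertionLetter g ℓ (N + 1) w x) (x + g) with hlt | hle
  · rw [h.Excl_eq_of_lt hlt] at hN
    exact hN (mem_erase.2 ⟨Ne.symm hne, mem_insert_self _ _⟩)
  · rw [h.Excl_eq_of_le hle] at hN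
    exact hN (mem_insert_self _ _)

lemma le_insertionLetter_of_mem_Excl (hN : N + 1 ∈ Excl g (g + ℓ) (N + 1) θ) :
    x + (g - 1) ≤ insertionLetter g ℓ (N + 1) w x := by
  by_contra hlt
  have hlast : N + 1 = insertionLetter g ℓ (N + 1) w x := by
    have := min_le_insertionLetter (g := g) (ℓ := ℓ) (N := N) (w := w) x
    have := (mem_Icc.1 h.letter_mem_Icc).2
    omega
  rw [h.Excl_eq_of_lt (by omega)] at hN
  exact ne_of_mem_erase hN hlast

lemma isAnchor_delta (hx : ℓ ≤ x) (hN : N + 1 ∈ Excl g (g + ℓ) (N + 1) θ) :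
    IsAnchor g ℓ (N + 1) θ x :=
  h.isAnchor_place hx (h.le_insertionLetter_of_mem_Excl hN) fun _ => insertionLetter_le

lemma apply_le_apply_place_of_isAnchor (hN : N + 1 ∈ Excl g (g + ℓ) (N + 1) θ)
    (hp : IsAnchor g ℓ (N + 1) θ p) : θ p ≤ θ x :=
  h.apply_place ▸ h.apply_le_letter_of_isAnchor (h.le_insertionLetter_of_mem_Excl hN) hp

lemma delta_unique (hx : ℓ ≤ x) (hx' : ℓ ≤ x')
    (h' : IsInsertion g ℓ N w' T x' (insertionLetter g ℓ (N + 1) w' x') θ) :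
    w = w' ∧ x = x' := by
  have hθ : θ x = θ x' := by
    by_cases hN : N + 1 ∈ Excl g (g + ℓ) (N + 1) θ
    · exact (h'.apply_le_apply_place_of_isAnchor hN (h.isAnchor_delta hx hN)).antisymm
        (h.apply_le_apply_place_of_isAnchor hN (h'.isAnchor_delta hx' hN))
    · rw [h.apply_place, h'.apply_place, h.insertionLetter_eq_of_notMem_Excl hN,
        h'.insertionLetter_eq_of_notMem_Excl hN]
  obtain rfl := h.isWord.injOn h.place_mem_Icc h'.place_mem_Icc hθ
  rw [← h'.apply_place, h.apply_place] at h'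
  exact ⟨h.word_unique h', rfl⟩

end Delta

section FirstLetter

variable (h : IsInsertion g ℓ N w T x (firstLetter g ℓ (N + 1) w) θ) (hx : x < ℓ)
include h hx

lemma not_isAnchor (p : ℕ) : ¬IsAnchor g ℓ (N + 1) θ p := by
  intro hp
  have hgap := h.add_gap_le_firstLetter hx
  have hpx : p ≠ x := by
    rintro rfl
    exact hx.not_ge hp.1
  obtain ⟨i, hi, rfl⟩ := h.exists_bump_place_eq (Excp_subset hp.2.1) hpx
  by_cases hiE : i ∈ Excp g (g + ℓ) N w
  · exact (h.apply_lt_letter_of_isAnchor (by omega) hiE hp).not_ge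
      (firstLetter_le (apply_mem_Excl hiE))
  · obtain ⟨hbump, -⟩ := h.bump_eq_self_of_mem_Excp_pred_gap (mem_Nexcp.2 ⟨hi, hiE⟩) hp.2.1
    have hℓi : ℓ ≤ i := hbump ▸ hp.1
    exact lt_asymm hx (hℓi.trans_lt (h.lt_place_of_bump_eq_self hi hℓi hbump))

lemma succ_mem_Excl : N + 1 ∈ Excl g (g + ℓ) (N + 1) θ :=
  h.Excl_eq_of_le (h.add_gap_le_firstLetter hx) ▸ mem_insert_self _ _

lemma firstLetter_unique (hx' : x' < ℓ)
    (h' : IsInsertion g ℓ N w' T' x' (firstLetter g ℓ (N + 1) w') θ) :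
    firstLetter g ℓ (N + 1) w = firstLetter g ℓ (N + 1) w' :=
  (h.firstLetter_le_of_mem_Excl hx (h'.firstLetter_mem_Excl hx')).antisymm
    (h'.firstLetter_le_of_mem_Excl hx' (h.firstLetter_mem_Excl hx))

lemma place_unique (hx' : x' < ℓ)
    (h' : IsInsertion g ℓ N w' T' x' (firstLetter g ℓ (N + 1) w') θ) : x = x' :=
  h.isWord.injOn h.place_mem_Icc h'.place_mem_Icc <| by
    rw [h.apply_place, h'.apply_place, h.firstLetter_unique hx hx' h']

end FirstLetter

lemma exists_bump_eq_level (h : IsInsertion g ℓ N w (S ∪ Icc ℓ N) x a θ) (hS : S ⊆ Ico 1 ℓ)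
    (hx : x ∈ S) : ∃ i ∈ S, bump (S ∪ Icc ℓ N) (N + 1) x i = ℓ := by
  have hN : ℓ ≤ N := by
    have := h.le_succ
    have := h.gap_pos
    omega
  have hlt : ∀ i ∈ S, i < ℓ := fun i hi => (mem_Ico.1 (hS hi)).2
  have hlevel : ℓ ∈ S.image (bump S ℓ x) := by
    rw [image_bump hlt (mem_insert_of_mem hx)]
    exact mem_erase.2 ⟨(hlt x hx).ne', mem_insert_self _ _⟩
  obtain ⟨i, hi, hil⟩ := mem_image.1 hlevel
  exact ⟨i, hi, by rw [bump_union_Icc_of_lt hS hN (hlt i hi), hil]⟩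

section Alpha

variable (h : IsInsertion g ℓ N w (setA g ℓ (N + 1) w ∪ Icc ℓ N) x
  (firstLetter g ℓ (N + 1) w) θ) (hx : x ∈ setA g ℓ (N + 1) w)
include h hx

lemma level_mem_Excp : ℓ ∈ Excp g (g + ℓ) (N + 1) θ := by
  obtain ⟨i, hi, hil⟩ := h.exists_bump_eq_level (setA_subset h.word) hx
  have hiE := ((mem_setA h.word).1 hi).1
  have hmem := (h.bump_mem_Excp (Excp_subset hiE)).2 hiE
  rwa [hil] at hmem

lemma filter_Excp_lt_level_of_mem_setA :
    {i ∈ Excp g (g + ℓ) (N + 1) θ | i < ℓ} = setA g ℓ (N + 1) w := by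
  have hxℓ := ((mem_setA h.word).1 hx).2
  have hN : ℓ ≤ N := by
    have := h.le_succ
    have := h.gap_pos
    omega
  have hlt : ∀ i ∈ setA g ℓ (N + 1) w, i < ℓ := fun i hi => ((mem_setA h.word).1 hi).2
  have himage := image_bump hlt (mem_insert_of_mem hx)
  have hbump : ∀ i < ℓ, bump (setA g ℓ (N + 1) w ∪ Icc ℓ N) (N + 1) x i =
      bump (setA g ℓ (N + 1) w) ℓ x i := fun i => bump_union_Icc_of_lt (setA_subset h.word) hN
  ext p
  rw [mem_filter, h.Excp_eq_of_le (h.add_gap_le_firstLetter hxℓ), mem_insert, mem_image]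
  constructor
  · rintro ⟨rfl | ⟨i, hi, rfl⟩, hp⟩
    · exact hx
    · have hil := (le_bump h.place_lt).trans_lt hp
      rw [hbump i hil] at hp ⊢
      exact mem_of_mem_insert_of_ne (bump_mem_insert ((mem_setA h.word).2 ⟨hi, hil⟩)) hp.ne
  · refine fun hp => ⟨or_iff_not_imp_left.2 fun hpx => ?_, hlt p hp⟩
    obtain ⟨i, hi, rfl⟩ := mem_image.1 (himage ▸ mem_erase.2 ⟨hpx, mem_insert_of_mem hp⟩)
    exact ⟨i, ((mem_setA h.word).1 hi).1, hbump i (hlt i hi)⟩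

lemma alpha_unique (hx' : x' ∈ setA g ℓ (N + 1) w')
    (h' : IsInsertion g ℓ N w' (setA g ℓ (N + 1) w' ∪ Icc ℓ N) x'
      (firstLetter g ℓ (N + 1) w') θ) : w = w' ∧ x = x' := by
  have hxℓ := ((mem_setA h.word).1 hx).2
  have hxℓ' := ((mem_setA h'.word).1 hx').2
  obtain rfl := h.place_unique hxℓ hxℓ' h'
  have hA := (h.filter_Excp_lt_level_of_mem_setA hx).symm.trans
    (h'.filter_Excp_lt_level_of_mem_setA hx')
  rw [← hA, ← h.firstLetter_unique hxℓ hxℓ h'] at h'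
  exact ⟨h.word_unique h', rfl⟩

end Alpha

section BetaStar

variable (h : IsInsertion g ℓ N w (setB g ℓ (N + 1) w ∪ Icc ℓ N) x
  (firstLetter g ℓ (N + 1) w) θ) (hx : x ∈ setB g ℓ (N + 1) w)
include h hx

lemma level_notMem_Excp : ℓ ∉ Excp g (g + ℓ) (N + 1) θ := by
  obtain ⟨i, hi, hil⟩ := h.exists_bump_eq_level (setB_subset h.word) hx
  have hiN := ((mem_setB h.word).1 hi).1
  have hmem := (h.bump_mem_Nexcp (Nexcp_subset hiN)).2 hiN
  rw [hil] at hmem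
  exact (mem_Nexcp.1 hmem).2

lemma betaStar_unique (hx' : x' ∈ setB g ℓ (N + 1) w')
    (h' : IsInsertion g ℓ N w' (setB g ℓ (N + 1) w' ∪ Icc ℓ N) x'
      (firstLetter g ℓ (N + 1) w') θ) : w = w' ∧ x = x' := by
  have hxℓ := ((mem_setB h.word).1 hx).2
  have hxℓ' := ((mem_setB h'.word).1 hx').2
  have hℓ : ℓ ≤ N + 1 := by
    have := h.le_succ
    omega
  obtain rfl := h.place_unique hxℓ hxℓ' h'
  have hA : insert x (setA g ℓ (N + 1) w) = insert x (setA g ℓ (N + 1) w') := by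
    rw [← h.filter_Excp_lt_level_of_mem_setB hx, h'.filter_Excp_lt_level_of_mem_setB hx']
  have hB : setB g ℓ (N + 1) w = setB g ℓ (N + 1) w' := by
    rw [setB_eq_sdiff h.word hℓ, setB_eq_sdiff h'.word hℓ,
      ← erase_insert (h.place_notMem_setA hx), hA, erase_insert (h'.place_notMem_setA hx')]
  rw [← hB, ← h.firstLetter_unique hxℓ hxℓ h'] at h'
  exact ⟨h.word_unique h', rfl⟩

end BetaStar

end IsInsertion

section Image

variable {g ℓ N x x' c c' : ℕ} {w w' θ : ℕ → ℕ}

/-- The word `θ` is obtained from the word `w` of length `N` by the one of the maps `α`, `β*` and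
`δ` that belongs to the space `x`. -/
inductive IsImage (g ℓ N : ℕ) (w : ℕ → ℕ) (x : ℕ) (θ : ℕ → ℕ) : Prop
  | alpha (hx : x ∈ setA g ℓ (N + 1) w)
      (h : IsInsertion g ℓ N w (setA g ℓ (N + 1) w ∪ Icc ℓ N) x (firstLetter g ℓ (N + 1) w) θ)
  | betaStar {v : ℕ → ℕ} (hx : x ∈ setB g ℓ (N + 1) w)
      (h : IsInsertion g ℓ N w (setB g ℓ (N + 1) w ∪ Icc ℓ N) x (firstLetter g ℓ (N + 1) w) v)
      (hθ : rotate g ℓ (N + 1) v = θ)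
  | delta (hx : ℓ ≤ x)
      (h : IsInsertion g ℓ N w (Icc ℓ N) x (insertionLetter g ℓ (N + 1) w x) θ)

lemma isImage_psi (hg : 1 ≤ g) (hℓ : 1 ≤ ℓ) (hn : g + ℓ ≤ N + 1) (hw : IsWord N w)
    (hc : c < N + 1) : IsImage g ℓ N w (space g ℓ (N + 1) w c) (psi g ℓ (N + 1) w c) := by
  have hspace := mem_Icc.1 (space_mem hg hℓ hn hw hc)
  rw [psi]
  split_ifs with hA hB
  · exact .alpha hA (isInsertion_setA hg hn hw hA)
  · exact .betaStar hB (isInsertion_setB hg hn hw hB) rfl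
  · have hlevel : ℓ ≤ space g ℓ (N + 1) w c := by
      by_contra hlt
      rw [mem_setA hw] at hA
      rw [mem_setB hw, mem_Nexcp, mem_Icc] at hB
      grind
    exact .delta hlevel (isInsertion_delta hg hℓ hn hw (mem_Icc.2 ⟨hlevel, hspace.2⟩))

namespace IsImage

lemma isWord (h : IsImage g ℓ N w x θ) : IsWord (N + 1) θ := by
  rcases h with ⟨-, h⟩ | ⟨-, h, rfl⟩ | ⟨-, h⟩
  exacts [h.isWord, isWord_rotate h.isWord, h.isWord]

lemma den_eq (h : IsImage g ℓ N w x θ) :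
    den g (g + ℓ) (N + 1) θ = den g (g + ℓ) N w + label g ℓ (N + 1) w x := by
  rcases h with ⟨hx, h⟩ | ⟨hx, h, rfl⟩ | ⟨hx, h⟩
  exacts [h.den_alpha hx, h.den_betaStar hx, h.den_delta hx]

lemma exc_eq (h : IsImage g ℓ N w x θ) : exc g ℓ (N + 1) θ =
    if label g ℓ (N + 1) w x ≤ exc g ℓ N w + g + ℓ - 2 then exc g ℓ N w
    else exc g ℓ N w + 1 := by
  rcases h with ⟨hx, h⟩ | ⟨hx, h, rfl⟩ | ⟨hx, h⟩
  exacts [h.exc_alpha hx, h.exc_betaStar hx, h.exc_delta hx]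

lemma lt_level_iff (h : IsImage g ℓ N w x θ) :
    x < ℓ ↔ N + 1 ∈ Excl g (g + ℓ) (N + 1) θ ∧ ∀ p, ¬IsAnchor g ℓ (N + 1) θ p := by
  rcases h with ⟨hx, h⟩ | ⟨hx, h, rfl⟩ | ⟨hx, h⟩
  · have hxℓ := ((mem_setA h.word).1 hx).2
    exact iff_of_true hxℓ ⟨h.succ_mem_Excl hxℓ, h.not_isAnchor hxℓ⟩
  · have hxℓ := ((mem_setB h.word).1 hx).2
    simp only [Excl_rotate h.isWord le_rfl, isAnchor_rotate h.isWord]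
    exact iff_of_true hxℓ ⟨h.succ_mem_Excl hxℓ, h.not_isAnchor hxℓ⟩
  · exact iff_of_false hx.not_gt fun hθ => hθ.2 x (h.isAnchor_delta hx hθ.1)

lemma mem_setA_iff (h : IsImage g ℓ N w x θ) :
    x ∈ setA g ℓ (N + 1) w ↔ x < ℓ ∧ ℓ ∈ Excp g (g + ℓ) (N + 1) θ := by
  rcases h with ⟨hx, h⟩ | ⟨hx, h, rfl⟩ | ⟨hx, h⟩
  · exact iff_of_true hx ⟨((mem_setA h.word).1 hx).2, h.level_mem_Excp hx⟩
  · rw [Excp_rotate h.isWord le_rfl]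
    exact iff_of_false (h.place_notMem_setA hx) fun hℓ => h.level_notMem_Excp hx hℓ.2
  · exact iff_of_false (fun hA => ((mem_setA h.word).1 hA).2.not_ge hx) fun hℓ => hℓ.1.not_ge hx

lemma unique (h : IsImage g ℓ N w x θ) (h' : IsImage g ℓ N w' x' θ) : w = w' ∧ x = x' := by
  have hlevel := h.lt_level_iff.trans h'.lt_level_iff.symm
  have hA : x ∈ setA g ℓ (N + 1) w ↔ x' ∈ setA g ℓ (N + 1) w' := by
    rw [h.mem_setA_iff, h'.mem_setA_iff, hlevel]
  rcases h with ⟨hx, h⟩ | ⟨hx, h, rfl⟩ | ⟨hx, h⟩ <;>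
    rcases h' with ⟨hx', h'⟩ | ⟨hx', h', hθ⟩ | ⟨hx', h'⟩
  · exact h.alpha_unique hx hx' h'
  · exact absurd (hA.1 hx) (h'.place_notMem_setA hx')
  · exact absurd (hlevel.1 ((mem_setA h.word).1 hx).2) hx'.not_gt
  · exact absurd (hA.2 hx') (h.place_notMem_setA hx)
  · obtain rfl := rotate_injOn h'.isWord h.isWord hθ
    exact h.betaStar_unique hx hx' h'
  · exact absurd (hlevel.1 ((mem_setB h.word).1 hx).2) hx'.not_gt
  · exact absurd (hlevel.2 ((mem_setA h'.word).1 hx').2) hx.not_gt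
  · exact absurd (hlevel.2 ((mem_setB h'.word).1 hx').2) hx.not_gt
  · exact h.delta_unique hx hx' h'

end IsImage

section Psi

variable (hg : 1 ≤ g) (hℓ : 1 ≤ ℓ) (hn : g + ℓ ≤ N + 1) (hw : IsWord N w) (hc : c < N + 1)
include hg hℓ hn hw hc

lemma isWord_psi : IsWord (N + 1) (psi g ℓ (N + 1) w c) := (isImage_psi hg hℓ hn hw hc).isWord

lemma den_psi : den g (g + ℓ) (N + 1) (psi g ℓ (N + 1) w c) = den g (g + ℓ) N w + c := by
  rw [(isImage_psi hg hℓ hn hw hc).den_eq, label_space hg hℓ hn hw hc]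

lemma exc_psi : exc g ℓ (N + 1) (psi g ℓ (N + 1) w c) =
    if c ≤ exc g ℓ N w + g + ℓ - 2 then exc g ℓ N w else exc g ℓ N w + 1 := by
  rw [(isImage_psi hg hℓ hn hw hc).exc_eq, label_space hg hℓ hn hw hc]

lemma psi_injective (hw' : IsWord N w') (hc' : c' < N + 1)
    (h : psi g ℓ (N + 1) w c = psi g ℓ (N + 1) w' c') : w = w' ∧ c = c' := by
  obtain ⟨rfl, hx⟩ := (isImage_psi hg hℓ hn hw hc).unique (h ▸ isImage_psi hg hℓ hn hw' hc')
  exact ⟨rfl, by rw [← label_space hg hℓ hn hw hc, hx, label_space hg hℓ hn hw hc']⟩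

end Psi

end Image

end GapDenert

theorem mainTheorem4 (g ℓ n : ℕ) (hg : 1 ≤ g) (hℓ : 1 ≤ ℓ) (hn : g + ℓ ≤ n) :
    ∃ ψ : Equiv.Perm (Fin (n - 1)) × Fin n → Equiv.Perm (Fin n),
      Function.Bijective ψ ∧
      ∀ (π : Equiv.Perm (Fin (n - 1))) (c : Fin n),
        GapDenert.oneLine (ψ (π, c)) = GapDenert.psi g ℓ n (GapDenert.oneLine π) (c : ℕ) ∧
        GapDenert.exc g ℓ n (GapDenert.oneLine (ψ (π, c))) =
          (if (c : ℕ) ≤ GapDenert.exc g ℓ (n - 1) (GapDenert.oneLine π) + g + ℓ - 2 then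
            GapDenert.exc g ℓ (n - 1) (GapDenert.oneLine π)
          else
            GapDenert.exc g ℓ (n - 1) (GapDenert.oneLine π) + 1) ∧
        GapDenert.den g (g + ℓ) n (GapDenert.oneLine (ψ (π, c))) =
          GapDenert.den g (g + ℓ) (n - 1) (GapDenert.oneLine π) + (c : ℕ) := by
  obtain ⟨N, rfl⟩ : ∃ N, n = N + 1 := ⟨n - 1, by omega⟩
  simp only [Nat.add_sub_cancel]
  have hword := GapDenert.isWord_oneLine (N := N)
  choose ψ hψ using fun q : Equiv.Perm (Fin N) × Fin (N + 1) =>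
    (GapDenert.isWord_psi hg hℓ hn (hword q.1) q.2.2).exists_oneLine_eq
  refine ⟨ψ, (Fintype.bijective_iff_injective_and_card ψ).2 ⟨?_, ?_⟩,
    fun π c => ⟨hψ (π, c), ?_, ?_⟩⟩
  · rintro ⟨π, c⟩ ⟨ρ, d⟩ h
    obtain ⟨hπρ, hcd⟩ := GapDenert.psi_injective hg hℓ hn (hword π) c.2 (hword ρ) d.2
      (by rw [← hψ (π, c), h, hψ (ρ, d)])
    rw [GapDenert.oneLine_injective hπρ, Fin.ext hcd]
  · rw [Fintype.card_prod, Fintype.card_perm, Fintype.card_perm, Fintype.card_fin,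
      Fintype.card_fin, Nat.factorial_succ, mul_comm]
  · rw [hψ (π, c), GapDenert.exc_psi hg hℓ hn (hword π) c.2]
  · rw [hψ (π, c), GapDenert.den_psi hg hℓ hn (hword π) c.2]
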